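/- Consider the Calogero--Moser derivative NLS $$ i\partial_t u+\partial_{xx}u+(D+|D|)(|u|^2)\,u=0,\qquad D=-i\partial_x, \tag{CM} $$ on $J\times\mathbb R$, where $J\subset\mathbb R$ is an interval with more than one point. Solutions are understood as follows: $u(t)\in H^1(\mathbb R)$ for all $t\in J$, and for every $t \in J$ the equation holds in the sense of distributions in $x$. Let $H^1_+(\mathbb R)=\{f\in H^1(\mathbb R):\operatorname{supp}\hat f\subset[0,\infty)\}$, $M(f)=\int_{\mathbb R}|f|^2\,dx$ and $\mathcal R(x)=\frac{\sqrt2}{x+i}$. A traveling solitary wave is a solution of (CM) of the form $$u(t,x)=e^{i\omega t}R_{v,\omega}(x-vt),\qquad v,\omega\in\mathbb R,\quad R_{v,\omega}\in H^1(\mathbb R)\setminus\{0\}.$$ (i) For every traveling solitary wave, $$\omega=\frac{v^2}{4},\qquad R_{v,\omega}(x)=e^{\frac i2vx}e^{i\theta}\lambda^{1/2}\mathcal R(\lambda x+y)$$ for some $\theta\in[0,2\pi)$, $\lambda>0$, $y\in\mathbb R$. Moreover, $R_{v,\omega}\in H^1_+(\mathbb R)$ if and only if $v\ge0$, and $M(u(t))=M(\mathcal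 R)=2\pi$ for all $t\in J$. (ii) Every traveling solitary wave with $u(t)\in H^1_+(\mathbb R)$ for all $t\in J$ is of the form $$u(t,x)=e^{i\theta+i\eta x-i\eta^2t}\lambda^{1/2}\mathcal R(\lambda(x-2\eta t)+y)$$ for some $\theta\in[0,2\pi)$, $y\in\mathbb R$, $\lambda>0$ and $\eta\ge0$. In particular $M(u(t))=M(\mathcal R)=2\pi$ for all $t \in J$. -/

import Mathlib

open MeasureTheory Set
open scoped FourierTransform SchwartzMap

noncomputable section

namespace CMDNLS

/-- `f` (a function on the line, understood up to null sets) belongs to the Sobolev space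
`H¹(ℝ)`: it is square integrable, and the tempered distribution it defines is a Sobolev function
of order `1` based on `L²`. -/
def MemH1 (f : ℝ → ℂ) : Prop :=
  ∃ hf : MemLp f 2 volume,
    TemperedDistribution.MemSobolev 1 2
      (Lp.toTemperedDistribution (hf.toLp f) : 𝓢'(ℝ, ℂ))

/-- `f` belongs to the Hardy-Sobolev space `H¹₊(ℝ)`: it is in `H¹(ℝ)`, and its (`L²`) Fourier
transform vanishes almost everywhere on the negative half-line, that is, has its support
in `[0, ∞)`. -/
def MemH1Plus (f : ℝ → ℂ) : Prop :=
  MemH1 f ∧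
    ∃ hf : MemLp f 2 volume,
      ∀ᵐ ξ : ℝ, ξ < 0 → (𝓕 (hf.toLp f : Lp ℂ 2 (volume : Measure ℝ)) : Lp ℂ 2 volume) ξ = 0

open scoped Classical in
/-- The (possibly unbounded) Fourier multiplier `m` on `L²(ℝ)`: its domain consists of those
`f ∈ L²` for which `m · 𝓕 f ∈ L²`, and there the result is `𝓕⁻¹ (m · 𝓕 f)`. Outside the domain
the value is `0` by convention. -/
def multiplier (m : ℝ → ℂ) (f : Lp ℂ 2 (volume : Measure ℝ)) : Lp ℂ 2 (volume : Measure ℝ) :=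
  if h : MemLp (fun ξ : ℝ => m ξ * (𝓕 f : Lp ℂ 2 (volume : Measure ℝ)) ξ) 2 volume then
    𝓕⁻ (h.toLp _ : Lp ℂ 2 (volume : Measure ℝ))
  else 0

open scoped Classical in
/-- The operator `D + |D|`, where `D = -i ∂ₓ`, with domain containing `H¹(ℝ)`. As Mathlib's Fourier
transform is `∫ exp (-2 π i x ξ) f x dx`, the symbol of `D` is `2 π ξ`, and the symbol of `|D|` is
its absolute value. (Every function `|u|²` with `u ∈ H¹(ℝ)` is in `H¹(ℝ)`, hence in the domain.) -/
def DAddAbsD (f : ℝ → ℂ) : Lp ℂ 2 (volume : Measure ℝ) :=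
  if hf : MemLp f 2 volume then
    multiplier (fun ξ : ℝ => ((2 * Real.pi * ξ + |2 * Real.pi * ξ| : ℝ) : ℂ)) (hf.toLp f)
  else 0

/-- `u` is an `H¹` solution on the time interval `J` of the Calogero--Moser derivative NLS
`i ∂ₜ u + ∂ₓₓ u + (D + |D|)(|u|²) u = 0`:
one has `u t ∈ H¹(ℝ)` for all `t ∈ J`, and the equation, in the form
`∂ₜ u = i ∂ₓₓ u + i (D + |D|)(|u|²) u`, holds at every time of `J` in the sense of distributions
in `x` (with the one-sided time derivative at those end points that belong to `J`). Continuity of `t ↦ u t` into `H¹(ℝ)` is not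
required, which only makes the notion weaker; it is automatic for waves
`exp (i ω t) R(x - v t)` with `R ∈ H¹(ℝ)`. -/
structure IsSolution (J : Set ℝ) (u : ℝ → ℝ → ℂ) : Prop where
  memH1 : ∀ t ∈ J, MemH1 (u t)
  equation : ∀ t ∈ J, ∀ φ : ℝ → ℂ, ContDiff ℝ (⊤ : ℕ∞) φ → HasCompactSupport φ →
    HasDerivWithinAt (fun s : ℝ => ∫ x : ℝ, u s x * φ x)
      (Complex.I * (∫ x : ℝ, u t x * iteratedDeriv 2 φ x) +
        Complex.I * ∫ x : ℝ, DAddAbsD (fun z : ℝ => ((‖u t z‖ ^ 2 : ℝ) : ℂ)) x * u t x * φ x)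
      J t

/-- `u` is a traveling solitary wave (with finite energy) on the time interval `J`, with velocity
`v`, frequency `ω` and profile `R ∈ H¹(ℝ) \ {0}`: it solves the equation and
`u(t, x) = exp (i ω t) R(x - v t)`. -/
structure IsTravelingWave (J : Set ℝ) (v ω : ℝ) (R : ℝ → ℂ) (u : ℝ → ℝ → ℂ) : Prop where
  profile_memH1 : MemH1 R
  profile_ne_zero : ¬ R =ᵐ[volume] 0
  form : ∀ t ∈ J, u t =ᵐ[volume] fun x : ℝ => Complex.exp (Complex.I * ω * t) * R (x - v * t)
  solution : IsSolution J u

/-- The ground state `𝓡(x) = √2 / (x + i)`. -/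
def groundState (x : ℝ) : ℂ := (Real.sqrt 2 : ℂ) / ((x : ℂ) + Complex.I)

/-- The `L²`-mass `M(f) = ∫ |f|² dx`. -/
def mass (f : ℝ → ℂ) : ℝ := ∫ x : ℝ, ‖f x‖ ^ 2

end CMDNLS

end

/-!
The Galilean gauge `exp (-i v x / 2)` turns a traveling wave into a solution of
`Q'' + (D + |D|)(|Q|²) Q = μ Q` with `μ = ω - v² / 4`. Since `(D + |D|) ρ = -i F'` for
`F = 2 Π₊ ρ`, where `Π₊` is the projection to the positive frequencies and `ρ = |Q|²`, the current
satisfies `Q̄ Q' - Q Q̄' = i ρ²`, and the momentum flux `S = |Q'|² - ρ³ / 3 - μ ρ` has the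
derivative `(i / 4) (F'² - conj F'²)`. The Fourier transform of `F'²` is a convolution of
functions that vanish to first order at the boundary of the positive half-line, so it is
`O(ξ³)`, whence `∫ S = 0`.

Because also `∫ F³ = 0`, the vanishing of `∫ S` is equivalent to that of `∫ |Q' - (i / 2) F Q|²`.
Hence `Q' = (i / 2) F Q`. This makes the real part of `F' - (i / 2) F²` zero, and a function with
only positive frequencies and zero real part vanishes, so `F' = (i / 2) F²`. Integrating
this Riccati equation makes `F` and `Q` explicit rational functions with a single pole, and the
equation then forces `μ = 0`.
-/

namespace CMDNLS

open Filter Topology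
open scoped Convolution ComplexConjugate Real
open Complex (I)

/-! ### Primitives -/

/-- `G` is an indefinite integral of the locally integrable function `g`: on the line these are
the pairs of a locally absolutely continuous function and its derivative. -/
structure IsPrimitive {E : Type*} [NormedAddCommGroup E] [NormedSpace ℝ E] (G g : ℝ → E) :
    Prop where
  locallyIntegrable : LocallyIntegrable g
  integral_eq : ∀ a b : ℝ, ∫ x in a..b, g x = G b - G a

lemma intervalIntegrable_of_locallyIntegrable {E : Type*} [NormedAddCommGroup E] {g : ℝ → E}
    (hg : LocallyIntegrable g) (a b : ℝ) : IntervalIntegrable g volume a b :=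
  (hg.integrableOn_isCompact isCompact_uIcc).intervalIntegrable

namespace IsPrimitive

section NormedSpace

variable {E F : Type*} [NormedAddCommGroup E] [NormedSpace ℝ E] [NormedAddCommGroup F]
  [NormedSpace ℝ F] {G g H h : ℝ → E}

lemma intervalIntegrable (hG : IsPrimitive G g) (a b : ℝ) : IntervalIntegrable g volume a b :=
  intervalIntegrable_of_locallyIntegrable hG.locallyIntegrable a b

lemma eq_add_integral (hG : IsPrimitive G g) (a : ℝ) : G = fun x => G a + ∫ t in a..x, g t := by
  ext x
  rw [hG.integral_eq, add_sub_cancel]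

lemma const_add_integral (hg : LocallyIntegrable g) (c : E) (a : ℝ) :
    IsPrimitive (fun x => c + ∫ t in a..x, g t) g :=
  ⟨hg, fun _ _ => by
    rw [add_sub_add_left_eq_sub, intervalIntegral.integral_interval_sub_left] <;>
      exact intervalIntegrable_of_locallyIntegrable hg _ _⟩

lemma continuous (hG : IsPrimitive G g) : Continuous G := by
  rw [hG.eq_add_integral 0]
  exact continuous_const.add (intervalIntegral.continuous_primitive hG.intervalIntegrable 0)

lemma congr_ae (hG : IsPrimitive G g) (hgh : g =ᵐ[volume] h) : IsPrimitive G h := by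
  refine ⟨hG.locallyIntegrable.congr hgh, fun a b => ?_⟩
  rw [← hG.integral_eq]
  exact intervalIntegral.integral_congr_ae (hgh.symm.mono fun x hx _ => hx)

lemma add (hG : IsPrimitive G g) (hH : IsPrimitive H h) :
    IsPrimitive (fun x => G x + H x) (fun x => g x + h x) := by
  refine ⟨hG.locallyIntegrable.add hH.locallyIntegrable, fun a b => ?_⟩
  rw [intervalIntegral.integral_add (hG.intervalIntegrable a b) (hH.intervalIntegrable a b),
    hG.integral_eq, hH.integral_eq, add_sub_add_comm]

lemma norm_le (hG : IsPrimitive G g) (hg : Integrable g) (x : ℝ) :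
    ‖G x‖ ≤ ‖G 0‖ + ∫ t, ‖g t‖ := by
  rw [eq_add_of_sub_eq' (hG.integral_eq 0 x).symm]
  refine (norm_add_le _ _).trans (add_le_add_right ?_ _)
  exact intervalIntegral.norm_integral_le_integral_norm_uIoc.trans
    (setIntegral_le_integral hg.norm (ae_of_all _ fun _ => norm_nonneg _))

/-- `G x - G (-x)` is integrable and converges to `∫ g`. -/
lemma integral_eq_zero (hG : IsPrimitive G g) (hGi : Integrable G) (hg : Integrable g) :
    ∫ x, g x = 0 := by
  have hlim := intervalIntegral_tendsto_integral hg tendsto_neg_atTop_atBot tendsto_id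
  simp only [hG.integral_eq, id] at hlim
  refine ((hGi.sub hGi.comp_neg).integrableAtFilter atTop).eq_zero_of_tendsto (fun s hs => ?_) hlim
  obtain ⟨b, hb⟩ := mem_atTop_sets.1 hs
  exact top_le_iff.1 (Real.volume_Ici (a := b) ▸ measure_mono hb)

variable [CompleteSpace E]

lemma ae_hasDerivAt (hG : IsPrimitive G g) : ∀ᵐ x, HasDerivAt G (g x) x := by
  filter_upwards [LocallyIntegrable.ae_hasDerivAt_integral hG.locallyIntegrable] with x hx
  rw [hG.eq_add_integral 0]
  exact (hx 0).const_add _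

lemma of_hasDerivAt (hG : ∀ x, HasDerivAt G (g x) x) (hg : Continuous g) : IsPrimitive G g :=
  ⟨hg.locallyIntegrable, fun a b => intervalIntegral.integral_eq_sub_of_hasDerivAt
    (fun x _ => hG x) (hg.intervalIntegrable a b)⟩

lemma hasDerivAt (hG : IsPrimitive G g) (hg : Continuous g) (x : ℝ) : HasDerivAt G (g x) x := by
  rw [hG.eq_add_integral 0]
  exact (hg.integral_hasStrictDerivAt 0 x).hasDerivAt.const_add _

lemma clm_comp [CompleteSpace F] (L : E →L[ℝ] F) (hG : IsPrimitive G g) :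
    IsPrimitive (fun x => L (G x)) (fun x => L (g x)) := by
  refine ⟨fun x => ?_, fun a b => ?_⟩
  · obtain ⟨s, hs, hi⟩ := hG.locallyIntegrable x
    exact ⟨s, hs, L.integrable_comp hi⟩
  · rw [L.intervalIntegral_comp_comm (hG.intervalIntegrable a b), hG.integral_eq, map_sub]

end NormedSpace

section AbsolutelyContinuous

variable {E : Type*} [NormedAddCommGroup E] [NormedSpace ℝ E] {G g : ℝ → E}

lemma absolutelyContinuousOnInterval (hG : IsPrimitive G g) (a b : ℝ) :
    AbsolutelyContinuousOnInterval G a b := by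
  have hn : ∀ c d : ℝ, IntervalIntegrable (fun x => ‖g x‖) volume c d :=
    fun c d => (hG.intervalIntegrable c d).norm
  refine squeeze_zero (fun t => Finset.sum_nonneg fun i _ => dist_nonneg)
    (fun t => Finset.sum_le_sum fun i _ => ?_)
    ((hn a b).absolutelyContinuousOnInterval_intervalIntegral (c := a) left_mem_uIcc)
  rw [Real.dist_eq, intervalIntegral.integral_interval_sub_left (hn _ _) (hn _ _), dist_eq_norm,
    ← hG.integral_eq]
  exact intervalIntegral.norm_integral_le_abs_integral_norm

lemma of_ae_hasDerivAt [CompleteSpace E] (hG : ∀ a b, AbsolutelyContinuousOnInterval G a b)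
    (hg : LocallyIntegrable g) (hd : ∀ᵐ x, HasDerivAt G (g x) x) : IsPrimitive G g := by
  refine ⟨hg, fun a b => ?_⟩
  have hP := const_add_integral hg 0 a
  obtain ⟨C, hC⟩ := ((hG a b).sub
    (hP.absolutelyContinuousOnInterval a b)).const_of_ae_hasDerivAt_zero (by
      filter_upwards [hd, hP.ae_hasDerivAt] with x hx hx' _
      simpa only [sub_self] using hx.sub hx')
  have ha := hC a left_mem_uIcc
  have hb := hC b right_mem_uIcc
  simp only [Pi.sub_apply, zero_add, intervalIntegral.integral_same, sub_zero] at ha hb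
  rw [ha, ← hb, sub_sub_cancel]

end AbsolutelyContinuous

section Mul

variable {𝕜 : Type*} [RCLike 𝕜] {G g H h : ℝ → 𝕜}

lemma star (hG : IsPrimitive G g) :
    IsPrimitive (fun x => starRingEnd 𝕜 (G x)) (fun x => starRingEnd 𝕜 (g x)) :=
  hG.clm_comp (RCLike.conjCLE (K := 𝕜)).toContinuousLinearMap

lemma mul (hG : IsPrimitive G g) (hH : IsPrimitive H h) :
    IsPrimitive (fun x => G x * H x) (fun x => g x * H x + G x * h x) := by
  have hL : LocallyIntegrable (fun x => g x * H x + G x * h x) := by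
    refine LocallyIntegrable.add (locallyIntegrableOn_univ.1 ?_) (locallyIntegrableOn_univ.1 ?_)
    · exact (hG.locallyIntegrable.locallyIntegrableOn univ).mul_continuousOn
        hH.continuous.continuousOn isOpen_univ.isLocallyClosed
    · exact (hH.locallyIntegrable.locallyIntegrableOn univ).continuousOn_mul
        hG.continuous.continuousOn isOpen_univ.isLocallyClosed
  refine of_ae_hasDerivAt (fun a b => ?_) hL ?_
  · exact (hG.absolutelyContinuousOnInterval a b).smul (hH.absolutelyContinuousOnInterval a b)
  · filter_upwards [hG.ae_hasDerivAt, hH.ae_hasDerivAt] with x hx hx' using hx.mul hx'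

lemma exists_norm_le_of_memLp (hG : IsPrimitive G g) (hG2 : MemLp G 2) (hg2 : MemLp g 2) :
    ∃ C, ∀ x, ‖G x‖ ≤ C := by
  have hi : Integrable fun x => g x * starRingEnd 𝕜 (G x) + G x * starRingEnd 𝕜 (g x) :=
    (hg2.integrable_mul hG2.star).add (hG2.integrable_mul hg2.star)
  have h := (hG.mul hG.star).norm_le hi
  simp only [norm_mul, RCLike.norm_conj, ← sq] at h
  exact ⟨_, fun x => Real.le_sqrt_of_sq_le (h x)⟩

end Mul

lemma exp_mul {G g : ℝ → ℂ} (hG : IsPrimitive G g) (c : ℂ) :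
    IsPrimitive (fun x : ℝ => Complex.exp (c * x) * G x)
      (fun x : ℝ => Complex.exp (c * x) * (c * G x + g x)) := by
  have hexp : IsPrimitive (fun x : ℝ => Complex.exp (c * x)) fun x : ℝ => Complex.exp (c * x) * c :=
    of_hasDerivAt (fun x => by
      simpa using! ((hasDerivAt_id (x : ℂ)).const_mul c).cexp.comp_ofReal) (by fun_prop)
  simpa only [mul_add, mul_assoc] using hexp.mul hG

end IsPrimitive

/-! ### Weak derivatives -/

/-- `g` is the derivative of `f` in the sense of distributions. -/
def IsWeakDeriv (f g : ℝ → ℂ) : Prop :=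
  ∀ φ : ℝ → ℂ, ContDiff ℝ (⊤ : ℕ∞) φ → HasCompactSupport φ →
    ∫ x, f x * deriv φ x = -∫ x, g x * φ x

lemma integrable_mul_of_hasCompactSupport {f φ : ℝ → ℂ} (hf : LocallyIntegrable f)
    (hφ : Continuous φ) (hs : HasCompactSupport φ) : Integrable (fun x => f x * φ x) := by
  simpa only [smul_eq_mul, mul_comm] using hf.integrable_smul_left_of_hasCompactSupport hφ hs

lemma IsPrimitive.isWeakDeriv {G g : ℝ → ℂ} (hG : IsPrimitive G g) : IsWeakDeriv G g := by
  intro φ hφ hs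
  obtain ⟨hd, hd'⟩ := contDiff_infty_iff_deriv.1 hφ
  have hGφ := hG.mul (IsPrimitive.of_hasDerivAt (fun x => (hd x).hasDerivAt) hd'.continuous)
  have i₁ := integrable_mul_of_hasCompactSupport hG.locallyIntegrable hφ.continuous hs
  have i₂ := integrable_mul_of_hasCompactSupport hG.continuous.locallyIntegrable hd'.continuous
    hs.deriv
  have h := hGφ.integral_eq_zero (integrable_mul_of_hasCompactSupport
    hG.continuous.locallyIntegrable hφ.continuous hs) (i₁.add i₂)
  rwa [integral_add i₁ i₂, add_eq_zero_iff_eq_neg'] at h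

lemma exists_deriv_eq_of_integral_eq_zero {χ : ℝ → ℂ} (hχ : ContDiff ℝ (⊤ : ℕ∞) χ)
    (hs : HasCompactSupport χ) (h0 : ∫ x, χ x = 0) :
    ∃ φ : ℝ → ℂ, ContDiff ℝ (⊤ : ℕ∞) φ ∧ HasCompactSupport φ ∧ deriv φ = χ := by
  obtain ⟨r, hr⟩ := hs.isCompact.isBounded.subset_ball (0 : ℝ)
  rw [Real.ball_eq_Ioo, zero_sub, zero_add] at hr
  have hsupp : Function.support χ ⊆ Ioo (-r) r := (subset_tsupport χ).trans hr
  have hd : ∀ x, HasDerivAt (fun x => ∫ t in -r..x, χ t) (χ x) x := fun x =>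
    (hχ.continuous.integral_hasStrictDerivAt (-r) x).hasDerivAt
  have hderiv : deriv (fun x => ∫ t in -r..x, χ t) = χ := funext fun x => (hd x).deriv
  refine ⟨_, contDiff_infty_iff_deriv.2 ⟨fun x => (hd x).differentiableAt, by rwa [hderiv]⟩,
    HasCompactSupport.intro (isCompact_Icc (a := -r) (b := r)) fun x hx => ?_, hderiv⟩
  rw [mem_Icc, not_and_or, not_le, not_le] at hx
  obtain hx | hx := hx
  · refine intervalIntegral.integral_zero_ae (ae_of_all _ fun t ht => ?_)
    rw [uIoc_of_ge hx.le] at ht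
    exact Function.notMem_support.1 fun h => ht.2.not_gt (hsupp h).1
  · rw [intervalIntegral.integral_eq_integral_of_support_subset, h0]
    exact fun t ht => ⟨(hsupp ht).1, (hsupp ht).2.le.trans hx.le⟩

lemma contDiff_ofReal_comp {ψ : ℝ → ℝ} (hψ : ContDiff ℝ (⊤ : ℕ∞) ψ) :
    ContDiff ℝ (⊤ : ℕ∞) fun x => (ψ x : ℂ) :=
  Complex.ofRealCLM.contDiff.comp hψ

lemma hasCompactSupport_ofReal_comp {ψ : ℝ → ℝ} (hs : HasCompactSupport ψ) :
    HasCompactSupport fun x => (ψ x : ℂ) :=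
  hs.comp_left (g := fun y : ℝ => (y : ℂ)) Complex.ofReal_zero

/-- Subtracting a multiple of a fixed bump function `θ` makes any test function a derivative. -/
lemma IsWeakDeriv.ae_eq_const {f : ℝ → ℂ} (hf : LocallyIntegrable f) (h : IsWeakDeriv f 0) :
    ∃ c : ℂ, f =ᵐ[volume] fun _ => c := by
  obtain ⟨θ, hθ, hθs, hθ1⟩ : ∃ θ : ℝ → ℂ, ContDiff ℝ (⊤ : ℕ∞) θ ∧ HasCompactSupport θ ∧
      ∫ x, θ x = 1 := by
    let b : ContDiffBump (0 : ℝ) := default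
    refine ⟨_, contDiff_ofReal_comp (b.contDiff_normed (μ := volume)),
      hasCompactSupport_ofReal_comp b.hasCompactSupport_normed, ?_⟩
    rw [integral_complex_ofReal, b.integral_normed, Complex.ofReal_one]
  refine ⟨∫ x, f x * θ x, ?_⟩
  refine ae_eq_of_integral_contDiff_smul_eq hf (locallyIntegrable_const _) fun ψ hψ hψs => ?_
  replace hψ := contDiff_ofReal_comp hψ
  replace hψs := hasCompactSupport_ofReal_comp hψs
  set c : ℂ := ∫ y, (ψ y : ℂ)
  obtain ⟨φ, hφ, hφs, hφ'⟩ := exists_deriv_eq_of_integral_eq_zero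
    (χ := fun x => (ψ x : ℂ) - c * θ x) (hψ.sub (contDiff_const.mul hθ)) (hψs.sub hθs.mul_left) (by
      rw [integral_sub (hψ.continuous.integrable_of_hasCompactSupport hψs)
        ((hθ.continuous.integrable_of_hasCompactSupport hθs).const_mul _), integral_const_mul, hθ1,
        mul_one, sub_self])
  have h0 := h φ hφ hφs
  simp only [hφ', Pi.zero_apply, zero_mul, integral_zero, neg_zero, mul_sub,
    mul_left_comm (f _) c] at h0
  rw [integral_sub (integrable_mul_of_hasCompactSupport hf hψ.continuous hψs)
    ((integrable_mul_of_hasCompactSupport hf hθ.continuous hθs).const_mul c),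
    integral_const_mul, sub_eq_zero] at h0
  simpa only [Complex.real_smul, integral_mul_const, mul_comm _ (f _)] using h0

lemma IsWeakDeriv.exists_isPrimitive {f g : ℝ → ℂ} (hf : LocallyIntegrable f)
    (hg : LocallyIntegrable g) (h : IsWeakDeriv f g) : ∃ G, IsPrimitive G g ∧ f =ᵐ[volume] G := by
  have hP := IsPrimitive.const_add_integral hg 0 0
  have hPl := hP.continuous.locallyIntegrable (μ := volume)
  obtain ⟨c, hc⟩ := IsWeakDeriv.ae_eq_const (hf.sub hPl) (fun φ hφ hs => by
    have hφ' := (contDiff_infty_iff_deriv.1 hφ).2.continuous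
    simp only [Pi.sub_apply, sub_mul]
    rw [integral_sub (integrable_mul_of_hasCompactSupport hf hφ' hs.deriv)
      (integrable_mul_of_hasCompactSupport hPl hφ' hs.deriv), h φ hφ hs, hP.isWeakDeriv φ hφ hs]
    simp only [Pi.zero_apply, zero_mul, integral_zero, sub_self, neg_zero])
  refine ⟨_, IsPrimitive.const_add_integral hg c 0, hc.mono fun x hx => ?_⟩
  simp only [Pi.sub_apply, zero_add] at hx
  exact sub_eq_iff_eq_add.1 hx

lemma MemH1.memLp {f : ℝ → ℂ} (hf : MemH1 f) : MemLp f 2 := hf.choose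

lemma MemH1.exists_isWeakDeriv {f : ℝ → ℂ} (hf : MemH1 f) :
    ∃ g : ℝ → ℂ, MemLp g 2 ∧ IsWeakDeriv f g := by
  obtain ⟨hf2, hS⟩ := hf
  have hd := hS.lineDerivOp (m := (1 : ℝ))
  rw [sub_self, TemperedDistribution.memSobolev_zero_iff] at hd
  obtain ⟨g, hg⟩ := hd
  refine ⟨g, Lp.memLp g, fun φ hφ hs => ?_⟩
  have h := congrArg (fun T : 𝓢'(ℝ, ℂ) => T (hs.toSchwartzMap hφ)) hg
  simp only [TemperedDistribution.lineDerivOp_apply_apply, map_neg,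
    Lp.toTemperedDistribution_apply, SchwartzMap.lineDerivOp_apply_eq_fderiv,
    HasCompactSupport.toSchwartzMap_toFun, smul_eq_mul, fderiv_apply_one_eq_deriv] at h
  simp only [mul_comm (g _), ← h, neg_neg]
  refine integral_congr_ae (hf2.coeFn_toLp.mono fun x hx => ?_)
  simp only [hx, mul_comm (f x), ← fderiv_apply_one_eq_deriv]
  rfl

/-! ### The Fourier transform -/

section Fourier

variable {V E : Type*} [NormedAddCommGroup V] [InnerProductSpace ℝ V] [FiniteDimensional ℝ V]
  [MeasurableSpace V] [BorelSpace V] [NormedAddCommGroup E] [NormedSpace ℂ E]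

lemma norm_fourier_le (f : V → E) (ξ : V) : ‖𝓕 f ξ‖ ≤ ∫ x, ‖f x‖ :=
  VectorFourier.norm_fourierIntegral_le_integral_norm _ _ _ _ _

lemma norm_fourierInv_le (f : V → E) (x : V) : ‖𝓕⁻ f x‖ ≤ ∫ ξ, ‖f ξ‖ := by
  rw [Real.fourierInv_eq_fourier_neg]
  exact norm_fourier_le f _

lemma continuous_fourier {f : V → E} (hf : Integrable f) : Continuous (𝓕 f) :=
  VectorFourier.fourierIntegral_continuous Real.continuous_fourierChar continuous_inner hf

lemma continuous_fourierInv {f : V → E} (hf : Integrable f) : Continuous (𝓕⁻ f) := by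
  rw [Real.fourierInv_eq_fourier_comp_neg]
  exact continuous_fourier hf.comp_neg

lemma fourierInv_add {f g : V → E} (hf : Integrable f) (hg : Integrable g) (x : V) :
    𝓕⁻ (fun ξ => f ξ + g ξ) x = 𝓕⁻ f x + 𝓕⁻ g x := by
  simp only [Real.fourierInv_eq_fourier_neg]
  exact congrFun (VectorFourier.fourierIntegral_add (L := innerₗ V) Real.continuous_fourierChar
    continuous_inner hf hg) (-x)

lemma fourierInv_const_mul (c : ℂ) (f : V → ℂ) (x : V) :
    𝓕⁻ (fun ξ => c * f ξ) x = c * 𝓕⁻ f x := by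
  simp only [Real.fourierInv_eq', smul_eq_mul, mul_left_comm _ c, integral_const_mul]

lemma fourier_conj (f : V → ℂ) (ξ : V) :
    𝓕 (fun x => conj (f x)) ξ = conj (𝓕 f (-ξ)) := by
  simp only [Real.fourier_eq', ← integral_conj, smul_eq_mul, map_mul, ← Complex.exp_conj,
    Complex.conj_I, Complex.conj_ofReal, inner_neg_right, Complex.ofReal_mul, Complex.ofReal_neg,
    mul_neg, neg_mul, neg_neg]

lemma conj_fourierInv (f : V → ℂ) (x : V) :
    conj (𝓕⁻ f x) = 𝓕⁻ (fun ξ => conj (f (-ξ))) x := by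
  rw [Real.fourierInv_eq_fourier_neg, Real.fourierInv_eq_fourier_comp_neg]
  simp only [neg_neg, fourier_conj]

lemma fourier_fourierInv_of_continuousAt [CompleteSpace E] {f : V → E} (hf : Integrable f)
    (hf' : Integrable (𝓕⁻ f)) {ξ : V} (hc : ContinuousAt f ξ) : 𝓕 (𝓕⁻ f) ξ = f ξ := by
  refine hf.fourier_fourierInv_eq (hf'.comp_neg.congr (ae_of_all _ fun x => ?_)) hc
  simp only [Real.fourierInv_eq_fourier_neg, neg_neg]

lemma integral_fourier_mul_eq {f g : V → ℂ} (hf : Integrable f) (hg : Integrable g) :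
    ∫ ξ, 𝓕 f ξ * g ξ = ∫ x, f x * 𝓕 g x := by
  simpa only [flip_innerₗ, smul_eq_mul] using! VectorFourier.integral_fourierIntegral_smul_eq_flip
    (L := innerₗ V) Real.continuous_fourierChar continuous_inner hf hg

lemma integral_fourierInv_mul_eq {f g : V → ℂ} (hf : Integrable f) (hg : Integrable g) :
    ∫ ξ, 𝓕⁻ f ξ * g ξ = ∫ x, f x * 𝓕⁻ g x := by
  rw [Real.fourierInv_eq_fourier_comp_neg g, ← integral_fourier_mul_eq hf hg.comp_neg,
    ← integral_neg_eq_self]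
  simp only [Real.fourierInv_eq_fourier_neg, neg_neg]

end Fourier

section LpFourier

variable {f : ℝ → ℂ}

lemma ae_eq_of_toTemperedDistribution_eq {f : Lp ℂ 2 (volume : Measure ℝ)} {g : ℝ → ℂ}
    (hg : LocallyIntegrable g)
    (h : ∀ φ : 𝓢(ℝ, ℂ), (f : 𝓢'(ℝ, ℂ)) φ = ∫ x, g x * φ x) :
    f =ᵐ[volume] g := by
  refine ae_eq_of_integral_contDiff_smul_eq ((Lp.memLp f).locallyIntegrable one_le_two) hg
    fun ψ hψ hψs => ?_
  have hφ := h ((hasCompactSupport_ofReal_comp hψs).toSchwartzMap (contDiff_ofReal_comp hψ))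
  rw [Lp.toTemperedDistribution_apply] at hφ
  simpa only [Complex.real_smul, smul_eq_mul, HasCompactSupport.toSchwartzMap_toFun,
    mul_comm (g _)] using hφ

lemma lpFourier_toLp_ae_eq (hf1 : Integrable f) (hf : MemLp f 2) :
    (𝓕 (hf.toLp f : Lp ℂ 2 (volume : Measure ℝ)) : Lp ℂ 2 volume) =ᵐ[volume] 𝓕 f := by
  refine ae_eq_of_toTemperedDistribution_eq (continuous_fourier hf1).locallyIntegrable
    fun φ => ?_
  rw [integral_fourier_mul_eq hf1 φ.integrable, ← Lp.fourier_toTemperedDistribution_eq,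
    TemperedDistribution.fourier_apply, Lp.toTemperedDistribution_apply, SchwartzMap.fourier_coe]
  refine integral_congr_ae (hf.coeFn_toLp.mono fun x hx => ?_)
  simp only [hx, smul_eq_mul, mul_comm]

lemma lpFourierInv_toLp_ae_eq (hf1 : Integrable f) (hf : MemLp f 2) :
    (𝓕⁻ (hf.toLp f : Lp ℂ 2 (volume : Measure ℝ)) : Lp ℂ 2 volume) =ᵐ[volume] 𝓕⁻ f := by
  refine ae_eq_of_toTemperedDistribution_eq (continuous_fourierInv hf1).locallyIntegrable
    fun φ => ?_
  rw [integral_fourierInv_mul_eq hf1 φ.integrable, ← Lp.fourierInv_toTemperedDistribution_eq,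
    TemperedDistribution.fourierInv_apply, Lp.toTemperedDistribution_apply,
    SchwartzMap.fourierInv_coe]
  refine integral_congr_ae (hf.coeFn_toLp.mono fun x hx => ?_)
  simp only [hx, smul_eq_mul, mul_comm]

lemma memLp_fourier (hf1 : Integrable f) (hf : MemLp f 2) : MemLp (𝓕 f) 2 :=
  (memLp_congr_ae (lpFourier_toLp_ae_eq hf1 hf)).1 (Lp.memLp _)

lemma memLp_fourierInv (hf1 : Integrable f) (hf : MemLp f 2) : MemLp (𝓕⁻ f) 2 :=
  (memLp_congr_ae (lpFourierInv_toLp_ae_eq hf1 hf)).1 (Lp.memLp _)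

end LpFourier

lemma fourier_eq_integral_exp_mul (f : ℝ → ℂ) (ξ : ℝ) :
    𝓕 f ξ = ∫ x : ℝ, Complex.exp (-(2 * π * I * ξ) * x) * f x := by
  rw [Real.fourier_real_eq_integral_exp_smul]
  congr 1 with x
  rw [smul_eq_mul]
  congr 2
  push_cast
  ring

lemma integrable_exp_mul {f : ℝ → ℂ} (hf : Integrable f) (ξ : ℝ) :
    Integrable fun x : ℝ => Complex.exp (-(2 * π * I * ξ) * x) * f x := by
  refine hf.bdd_mul (c := 1) (by fun_prop) (ae_of_all _ fun x => ?_)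
  simp [Complex.norm_exp]

lemma IsPrimitive.fourier_eq {G g : ℝ → ℂ} (h : IsPrimitive G g) (hG : Integrable G)
    (hg : Integrable g) (ξ : ℝ) : 𝓕 g ξ = 2 * π * I * ξ * 𝓕 G ξ := by
  set c : ℂ := -(2 * π * I * ξ) with hc
  have hsum : ∀ x : ℝ, Complex.exp (c * x) * (c * G x + g x) =
      c * (Complex.exp (c * x) * G x) + Complex.exp (c * x) * g x := fun x => by ring
  have hiG := (integrable_exp_mul hG ξ).const_mul c
  have hig := integrable_exp_mul hg ξ
  have h0 := (h.exp_mul c).integral_eq_zero (integrable_exp_mul hG ξ)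
    ((hiG.add hig).congr (ae_of_all _ fun x => (hsum x).symm))
  rw [integral_congr_ae (ae_of_all _ hsum), integral_add hiG hig, integral_const_mul, ← hc,
    ← fourier_eq_integral_exp_mul, ← fourier_eq_integral_exp_mul] at h0
  rw [eq_neg_of_add_eq_zero_right h0, hc, neg_mul, neg_neg]

lemma fourier_sub {f g : ℝ → ℂ} (hf : Integrable f) (hg : Integrable g) (ξ : ℝ) :
    𝓕 (fun x => f x - g x) ξ = 𝓕 f ξ - 𝓕 g ξ := by
  simp only [fourier_eq_integral_exp_mul, mul_sub]
  exact integral_sub (integrable_exp_mul hf ξ) (integrable_exp_mul hg ξ)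

lemma fourier_const_mul (c : ℂ) (f : ℝ → ℂ) (ξ : ℝ) :
    𝓕 (fun x => c * f x) ξ = c * 𝓕 f ξ := by
  simp only [fourier_eq_integral_exp_mul, mul_left_comm _ c, integral_const_mul]

lemma integral_eq_zero_of_norm_fourier_le {f : ℝ → ℂ} (hf : Integrable f) {C : ℝ}
    (hC : ∀ ξ, 0 < ξ → ‖𝓕 f ξ‖ ≤ C * ξ ^ 2) : ∫ x, f x = 0 := by
  have hbound : Tendsto (fun ξ : ℝ => C * ξ ^ 2) (𝓝[>] (0 : ℝ)) (𝓝 0) := by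
    have h : Continuous fun ξ : ℝ => C * ξ ^ 2 := by fun_prop
    simpa using (h.tendsto 0).mono_left nhdsWithin_le_nhds
  have h0 : 𝓕 f 0 = 0 := tendsto_nhds_unique (l := 𝓝[>] (0 : ℝ))
    (((continuous_fourier hf).tendsto 0).mono_left nhdsWithin_le_nhds)
    (squeeze_zero_norm' (eventually_mem_nhdsWithin.mono hC) hbound)
  rw [fourier_eq_integral_exp_mul] at h0
  simpa only [Complex.ofReal_zero, mul_zero, neg_zero, zero_mul, Complex.exp_zero, one_mul] using h0

/-! ### Hardy functions -/

section Convolution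

open ContinuousLinearMap (mul)

variable {a b : ℝ → ℂ}

lemma continuous_convolution_of_ae_continuousAt (ha : Integrable a)
    (hb : AEStronglyMeasurable b) {C : ℝ} (hC : ∀ x, ‖b x‖ ≤ C)
    (hbc : ∀ᵐ x, ContinuousAt b x) : Continuous (a ⋆[mul ℂ ℂ] b) := by
  refine continuous_iff_continuousAt.2 fun ξ => continuousAt_of_dominated
    (bound := fun t => ‖a t‖ * C) (Eventually.of_forall fun x => ?_)
    (Eventually.of_forall fun x => ae_of_all _ fun t => ?_) (ha.norm.mul_const C) ?_
  · exact ha.aestronglyMeasurable.mul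
      (hb.comp_quasiMeasurePreserving (quasiMeasurePreserving_sub_left volume x))
  · rw [ContinuousLinearMap.mul_apply', norm_mul]
    exact mul_le_mul_of_nonneg_left (hC _) (norm_nonneg _)
  · filter_upwards [(quasiMeasurePreserving_sub_left volume ξ).ae hbc] with t ht
    exact continuousAt_const.mul (ContinuousAt.comp (f := fun x => x - t) ht (by fun_prop))

lemma convolution_eq_zero_of_nonpos (ha : ∀ x ≤ 0, a x = 0) (hb : ∀ x ≤ 0, b x = 0) {ξ : ℝ}
    (hξ : ξ ≤ 0) : (a ⋆[mul ℂ ℂ] b) ξ = 0 := by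
  refine integral_eq_zero_of_ae (ae_of_all _ fun t => ?_)
  obtain ht | ht := le_or_gt t 0
  · simp only [ContinuousLinearMap.mul_apply', ha t ht, zero_mul, Pi.zero_apply]
  · simp only [ContinuousLinearMap.mul_apply', hb (ξ - t) (by linarith), mul_zero, Pi.zero_apply]

lemma norm_convolution_le (ha : Integrable a) {C : ℝ} (hC : ∀ x, ‖b x‖ ≤ C) (ξ : ℝ) :
    ‖(a ⋆[mul ℂ ℂ] b) ξ‖ ≤ (∫ t, ‖a t‖) * C := by
  rw [convolution_def, ← integral_mul_const]
  refine norm_integral_le_of_norm_le (ha.norm.mul_const C) (ae_of_all _ fun t => ?_)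
  rw [ContinuousLinearMap.mul_apply', norm_mul]
  exact mul_le_mul_of_nonneg_left (hC _) (norm_nonneg _)

lemma fourierInv_convolution (ha : Integrable a) (hb : Integrable b) (x : ℝ) :
    𝓕⁻ (a ⋆[mul ℂ ℂ] b) x = 𝓕⁻ a x * 𝓕⁻ b x := by
  simp only [Real.fourierInv_eq_fourier_neg]
  exact Real.fourier_mul_convolution_eq ha hb _

lemma norm_convolution_le_mul_pow_three {A B : ℝ} (ha : ∀ x ≤ 0, a x = 0) (hb : ∀ x ≤ 0, b x = 0)
    (hA : ∀ x, 0 < x → ‖a x‖ ≤ A * x) (hB : ∀ x, 0 < x → ‖b x‖ ≤ B * x) {ξ : ℝ} (hξ : 0 ≤ ξ) :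
    ‖(a ⋆[mul ℂ ℂ] b) ξ‖ ≤ A * B * ξ ^ 3 := by
  have hA0 : 0 ≤ A := by simpa using (norm_nonneg _).trans (hA 1 one_pos)
  have hB0 : 0 ≤ B := by simpa using (norm_nonneg _).trans (hB 1 one_pos)
  have hIoo : (a ⋆[mul ℂ ℂ] b) ξ = ∫ t in Ioo 0 ξ, a t * b (ξ - t) := by
    refine (setIntegral_eq_integral_of_forall_compl_eq_zero fun t ht => ?_).symm
    rw [mem_Ioo, not_and_or, not_lt, not_lt] at ht
    obtain ht | ht := ht
    · rw [ContinuousLinearMap.mul_apply', ha t ht, zero_mul]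
    · rw [ContinuousLinearMap.mul_apply', hb _ (sub_nonpos.2 ht), mul_zero]
  have hle : ∀ t ∈ Ioo 0 ξ, ‖a t * b (ξ - t)‖ ≤ A * ξ * (B * ξ) := fun t ht => by
    rw [norm_mul]
    gcongr
    · exact (hA t ht.1).trans (by gcongr; exact ht.2.le)
    · exact (hB _ (sub_pos.2 ht.2)).trans (by gcongr; exact sub_le_self _ ht.1.le)
  rw [hIoo]
  calc ‖∫ t in Ioo 0 ξ, a t * b (ξ - t)‖
      ≤ A * ξ * (B * ξ) * volume.real (Ioo 0 ξ) :=
        norm_setIntegral_le_of_norm_le_const measure_Ioo_lt_top hle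
    _ = A * B * ξ ^ 3 := by rw [Real.volume_real_Ioo_of_le hξ]; ring

/-- `a` is the Fourier transform of a Hardy function `𝓕⁻ a`, a function without negative
frequencies. The regularity is what the densities below provide: there may be a jump at `0`. -/
structure IsHardySymbol (a : ℝ → ℂ) : Prop where
  integrable : Integrable a
  exists_norm_le : ∃ C, ∀ ξ, ‖a ξ‖ ≤ C
  continuousOn : ContinuousOn a (Ioi 0)
  eq_zero : ∀ ξ ≤ 0, a ξ = 0

namespace IsHardySymbol

lemma continuousAt (ha : IsHardySymbol a) {ξ : ℝ} (hξ : ξ ≠ 0) : ContinuousAt a ξ := by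
  obtain hξ | hξ := hξ.lt_or_gt
  · refine (continuousAt_const (y := (0 : ℂ))).congr ?_
    filter_upwards [Iio_mem_nhds hξ] with x hx using (ha.eq_zero x hx.le).symm
  · exact ha.continuousOn.continuousAt (Ioi_mem_nhds hξ)

lemma add (ha : IsHardySymbol a) (hb : IsHardySymbol b) : IsHardySymbol fun ξ => a ξ + b ξ where
  integrable := ha.integrable.add hb.integrable
  exists_norm_le := by
    obtain ⟨A, hA⟩ := ha.exists_norm_le
    obtain ⟨B, hB⟩ := hb.exists_norm_le
    exact ⟨A + B, fun ξ => norm_add_le_of_le (hA ξ) (hB ξ)⟩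
  continuousOn := ha.continuousOn.add hb.continuousOn
  eq_zero ξ hξ := by rw [ha.eq_zero ξ hξ, hb.eq_zero ξ hξ, add_zero]

lemma const_mul (c : ℂ) (ha : IsHardySymbol a) : IsHardySymbol fun ξ => c * a ξ where
  integrable := ha.integrable.const_mul c
  exists_norm_le := by
    obtain ⟨A, hA⟩ := ha.exists_norm_le
    exact ⟨‖c‖ * A, fun ξ => (norm_mul _ _).trans_le (by gcongr; exact hA ξ)⟩
  continuousOn := continuousOn_const.mul ha.continuousOn
  eq_zero ξ hξ := by rw [ha.eq_zero ξ hξ, mul_zero]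

lemma continuous_convolution (ha : IsHardySymbol a) (hb : IsHardySymbol b) :
    Continuous (a ⋆[mul ℂ ℂ] b) := by
  obtain ⟨B, hB⟩ := hb.exists_norm_le
  refine continuous_convolution_of_ae_continuousAt ha.integrable hb.integrable.aestronglyMeasurable
    hB ?_
  filter_upwards [Measure.ae_ne volume 0] with ξ hξ using hb.continuousAt hξ

lemma convolution (ha : IsHardySymbol a) (hb : IsHardySymbol b) :
    IsHardySymbol (a ⋆[mul ℂ ℂ] b) where
  integrable := ha.integrable.integrable_convolution _ hb.integrable
  exists_norm_le := hb.exists_norm_le.elim fun _ hB => ⟨_, norm_convolution_le ha.integrable hB⟩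
  continuousOn := (ha.continuous_convolution hb).continuousOn
  eq_zero _ hξ := convolution_eq_zero_of_nonpos ha.eq_zero hb.eq_zero hξ

lemma fourier_mul_eq (ha : IsHardySymbol a) (hb : IsHardySymbol b)
    (hi : Integrable fun x => 𝓕⁻ a x * 𝓕⁻ b x) :
    𝓕 (fun x => 𝓕⁻ a x * 𝓕⁻ b x) = a ⋆[mul ℂ ℂ] b := by
  have h𝓕 : 𝓕⁻ (a ⋆[mul ℂ ℂ] b) = fun x => 𝓕⁻ a x * 𝓕⁻ b x :=
    funext (fourierInv_convolution ha.integrable hb.integrable)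
  rw [← h𝓕]
  exact funext fun ξ => fourier_fourierInv_of_continuousAt (ha.convolution hb).integrable
    (h𝓕 ▸ hi) (ha.continuous_convolution hb).continuousAt

lemma integral_mul_eq_zero (ha : IsHardySymbol a) (hb : IsHardySymbol b)
    (hi : Integrable fun x => 𝓕⁻ a x * 𝓕⁻ b x) : ∫ x, 𝓕⁻ a x * 𝓕⁻ b x = 0 := by
  have h0 := congrFun (ha.fourier_mul_eq hb hi) 0
  rw [(ha.convolution hb).eq_zero 0 le_rfl, fourier_eq_integral_exp_mul] at h0
  simpa only [Complex.ofReal_zero, mul_zero, neg_zero, zero_mul, Complex.exp_zero, one_mul]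
    using h0

/-- The positive frequencies of `𝓕⁻ a` are those of its real part. -/
lemma fourierInv_eq_zero_of_re_eq_zero (ha : IsHardySymbol a) (hre : ∀ x, (𝓕⁻ a x).re = 0)
    (x : ℝ) : 𝓕⁻ a x = 0 := by
  have hi : Integrable fun ξ => conj (a (-ξ)) :=
    Complex.conjCLE.toContinuousLinearMap.integrable_comp ha.integrable.comp_neg
  have hk : Integrable fun ξ => a ξ + conj (a (-ξ)) := ha.integrable.add hi
  have h𝓕 : 𝓕⁻ (fun ξ => a ξ + conj (a (-ξ))) = 0 := by
    ext x
    rw [fourierInv_add ha.integrable hi, ← conj_fourierInv, Complex.add_conj, hre, mul_zero,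
      Complex.ofReal_zero, Pi.zero_apply]
  have ha0 : a = fun _ => 0 := by
    ext ξ
    obtain hξ | hξ := le_or_gt ξ 0
    · exact ha.eq_zero ξ hξ
    have hc : ContinuousAt (fun ξ => a ξ + conj (a (-ξ))) ξ :=
      (ha.continuousAt hξ.ne').add (Complex.continuous_conj.continuousAt.comp
        (ContinuousAt.comp (ha.continuousAt (neg_ne_zero.2 hξ.ne')) continuous_neg.continuousAt))
    have h := fourier_fourierInv_of_continuousAt hk (h𝓕 ▸ integrable_zero _ _ _) hc
    simpa only [h𝓕, fourier_eq_integral_exp_mul, Pi.zero_apply, mul_zero, integral_zero,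
      ha.eq_zero (-ξ) (neg_nonpos.2 hξ.le), map_zero, add_zero, eq_comm] using h
  rw [ha0, Real.fourierInv_eq']
  simp only [smul_zero, integral_zero]

end IsHardySymbol

end Convolution

/-- `ρ` is a continuous real function of the form `(1 - ∂ₓₓ)⁻¹ σ` with `σ ∈ L¹ ∩ L²`. This is the
regularity of `|Q|²` for solutions `Q` of the stationary equation. -/
structure IsRegularDensity (ρ : ℝ → ℂ) : Prop where
  continuous : Continuous ρ
  conj_eq : ∀ x, conj (ρ x) = ρ x
  integrable : Integrable ρ
  memLp : MemLp ρ 2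
  exists_fourier_eq : ∃ σ : ℝ → ℂ, Integrable σ ∧ MemLp σ 2 ∧
    ∀ ξ : ℝ, (1 + (2 * π * ξ) ^ 2) * 𝓕 ρ ξ = 𝓕 σ ξ

/-- The Fourier transform of `2 Π₊ ρ`, where `Π₊` is the projection to the positive frequencies. -/
noncomputable def posFreq (ρ : ℝ → ℂ) : ℝ → ℂ := (Ioi 0).indicator fun ξ => 2 * 𝓕 ρ ξ

/-- The Fourier transform of the derivative of `2 Π₊ ρ`. -/
noncomputable def posFreqDeriv (ρ : ℝ → ℂ) : ℝ → ℂ :=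
  (Ioi 0).indicator fun ξ => 2 * (2 * π * I * ξ * 𝓕 ρ ξ)

/-- The function `2 Π₊ ρ`, of which `ρ` is the real part if `ρ` is real. -/
noncomputable def hardyPart (ρ : ℝ → ℂ) : ℝ → ℂ := 𝓕⁻ (posFreq ρ)

/-- The derivative of `2 Π₊ ρ`. -/
noncomputable def hardyDeriv (ρ : ℝ → ℂ) : ℝ → ℂ := 𝓕⁻ (posFreqDeriv ρ)

lemma posFreqDeriv_eq (ρ : ℝ → ℂ) (ξ : ℝ) :
    posFreqDeriv ρ ξ = 2 * π * I * ξ * posFreq ρ ξ := by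
  simp only [posFreqDeriv, posFreq, indicator_apply]
  split_ifs
  · ring
  · rw [mul_zero]

lemma integrable_inv_one_add_two_pi_mul_sq :
    Integrable fun ξ : ℝ => (1 + (2 * π * ξ) ^ 2)⁻¹ :=
  integrable_inv_one_add_sq.comp_mul_left' Real.two_pi_pos.ne'

lemma isHardySymbol_indicator {a : ℝ → ℂ} (ha : Continuous a) (hi : Integrable a)
    (hb : ∃ C, ∀ ξ, ‖a ξ‖ ≤ C) : IsHardySymbol ((Ioi 0).indicator a) where
  integrable := hi.indicator measurableSet_Ioi
  exists_norm_le := hb.imp fun _ hC ξ => (norm_indicator_le_norm_self _ _).trans (hC ξ)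
  continuousOn := ha.continuousOn.congr fun _ hξ => indicator_of_mem hξ _
  eq_zero _ hξ := indicator_of_notMem (notMem_Ioi.2 hξ) _

lemma dAddAbsD_congr_ae {f g : ℝ → ℂ} (h : f =ᵐ[volume] g) : DAddAbsD f = DAddAbsD g := by
  by_cases hf : MemLp f 2
  · have hg := (memLp_congr_ae h).1 hf
    rw [DAddAbsD, DAddAbsD, dif_pos hf, dif_pos hg, (MemLp.toLp_eq_toLp_iff hf hg).2 h]
  · rw [DAddAbsD, DAddAbsD, dif_neg hf, dif_neg (mt (memLp_congr_ae h).2 hf)]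

namespace IsRegularDensity

variable {ρ : ℝ → ℂ}

lemma fourier_neg (h : IsRegularDensity ρ) (ξ : ℝ) : 𝓕 ρ (-ξ) = conj (𝓕 ρ ξ) := by
  simpa only [h.conj_eq, neg_neg] using fourier_conj ρ (-ξ)

lemma integrable_fourier (h : IsRegularDensity ρ) : Integrable (𝓕 ρ) := by
  obtain ⟨σ, -, -, hρσ⟩ := h.exists_fourier_eq
  refine (integrable_inv_one_add_two_pi_mul_sq.mul_const (∫ x, ‖σ x‖)).mono'
    (continuous_fourier h.integrable).aestronglyMeasurable (ae_of_all _ fun ξ => ?_)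
  have hs : 0 < 1 + (2 * π * ξ) ^ 2 := by positivity
  have hnorm : ‖(1 + (2 * π * ξ) ^ 2 : ℂ)‖ = 1 + (2 * π * ξ) ^ 2 := by
    rw [← Complex.norm_of_nonneg hs.le]
    push_cast
    rfl
  rw [inv_mul_eq_div, le_div_iff₀' hs, ← hnorm, ← norm_mul, hρσ]
  exact norm_fourier_le σ ξ

lemma fourierInv_fourier (h : IsRegularDensity ρ) : 𝓕⁻ (𝓕 ρ) = ρ :=
  h.continuous.fourierInv_fourier_eq h.integrable h.integrable_fourier

lemma exists_norm_le (h : IsRegularDensity ρ) : ∃ C, ∀ x, ‖ρ x‖ ≤ C :=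
  ⟨_, fun x => h.fourierInv_fourier ▸ norm_fourierInv_le (𝓕 ρ) x⟩

/-- The factors are `2 π ξ / (1 + (2 π ξ)²)` and the Fourier transform of `i (1 - ∂ₓₓ) ρ`. -/
lemma exists_mul_eq_mul_fourier (h : IsRegularDensity ρ) : ∃ m τ : ℝ → ℂ,
    MemLp m 2 ∧ (∀ ξ, ‖m ξ‖ ≤ 1) ∧ MemLp τ 2 ∧ (∃ C, ∀ ξ, ‖τ ξ‖ ≤ C) ∧
    (fun ξ => m ξ * τ ξ) = fun ξ : ℝ => 2 * π * I * ξ * 𝓕 ρ ξ := by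
  obtain ⟨σ, hσ, hσ2, hρσ⟩ := h.exists_fourier_eq
  have hpos : ∀ ξ : ℝ, 0 < 1 + (2 * π * ξ) ^ 2 := fun ξ => by positivity
  set m : ℝ → ℝ := fun ξ => 2 * π * ξ / (1 + (2 * π * ξ) ^ 2) with hm
  have hm_sq : ∀ ξ, m ξ ^ 2 ≤ (1 + (2 * π * ξ) ^ 2)⁻¹ := fun ξ => by
    rw [hm, div_pow, div_le_iff₀ (pow_pos (hpos ξ) 2), sq (1 + _),
      inv_mul_cancel_left₀ (hpos ξ).ne']
    linarith
  have hm_cont : Continuous m := Continuous.div (by fun_prop) (by fun_prop) fun ξ => (hpos ξ).ne'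
  refine ⟨fun ξ => m ξ, fun ξ => I * 𝓕 σ ξ, MemLp.ofReal ?_, fun ξ => ?_,
    (memLp_fourier hσ hσ2).const_mul _, ⟨∫ x, ‖σ x‖, fun ξ => ?_⟩, funext fun ξ => ?_⟩
  · refine (memLp_two_iff_integrable_sq hm_cont.aestronglyMeasurable).2
      (integrable_inv_one_add_two_pi_mul_sq.mono' (hm_cont.pow 2).aestronglyMeasurable
        (ae_of_all _ fun ξ => ?_))
    rw [Real.norm_of_nonneg (sq_nonneg _)]
    exact hm_sq ξ
  · rw [Complex.norm_real, Real.norm_eq_abs, ← sq_le_one_iff_abs_le_one]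
    exact (hm_sq ξ).trans (inv_le_one_of_one_le₀ (le_add_of_nonneg_right (sq_nonneg _)))
  · rw [norm_mul, Complex.norm_I, one_mul]
    exact norm_fourier_le σ ξ
  · have hne : (1 + (2 * π * ξ) ^ 2 : ℂ) ≠ 0 := by exact_mod_cast (hpos ξ).ne'
    simp only [hm, ← hρσ, Complex.ofReal_div, Complex.ofReal_add, Complex.ofReal_pow,
      Complex.ofReal_mul, Complex.ofReal_one, Complex.ofReal_ofNat]
    rw [div_mul_eq_mul_div, div_eq_iff hne]
    ring

lemma integrable_mul_fourier (h : IsRegularDensity ρ) :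
    Integrable fun ξ : ℝ => 2 * π * I * ξ * 𝓕 ρ ξ := by
  obtain ⟨m, τ, hm, -, hτ, -, hmτ⟩ := h.exists_mul_eq_mul_fourier
  exact hmτ ▸ hm.integrable_mul hτ

lemma memLp_mul_fourier (h : IsRegularDensity ρ) :
    MemLp (fun ξ : ℝ => 2 * π * I * ξ * 𝓕 ρ ξ) 2 := by
  obtain ⟨m, τ, hm, hm1, hτ, -, hmτ⟩ := h.exists_mul_eq_mul_fourier
  refine hmτ ▸ hτ.mono (hm.1.mul hτ.1) (ae_of_all _ fun ξ => ?_)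
  rw [norm_mul]
  exact mul_le_of_le_one_left (norm_nonneg _) (hm1 ξ)

lemma exists_norm_mul_fourier_le (h : IsRegularDensity ρ) :
    ∃ C, ∀ ξ : ℝ, ‖2 * π * I * ξ * 𝓕 ρ ξ‖ ≤ C := by
  obtain ⟨m, τ, -, hm1, -, ⟨C, hC⟩, hmτ⟩ := h.exists_mul_eq_mul_fourier
  refine ⟨C, fun ξ => ?_⟩
  rw [← congrFun hmτ ξ, norm_mul]
  exact (mul_le_of_le_one_left (norm_nonneg _) (hm1 ξ)).trans (hC ξ)

lemma isHardySymbol_posFreq (h : IsRegularDensity ρ) : IsHardySymbol (posFreq ρ) :=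
  isHardySymbol_indicator (continuous_const.mul (continuous_fourier h.integrable))
    (h.integrable_fourier.const_mul 2) ⟨2 * ∫ x, ‖ρ x‖, fun ξ => by
      rw [norm_mul, Complex.norm_ofNat]
      exact mul_le_mul_of_nonneg_left (norm_fourier_le ρ ξ) zero_le_two⟩

lemma isHardySymbol_posFreqDeriv (h : IsRegularDensity ρ) : IsHardySymbol (posFreqDeriv ρ) :=
  have hc := continuous_fourier h.integrable
  isHardySymbol_indicator (by fun_prop) (h.integrable_mul_fourier.const_mul 2) <| by
    obtain ⟨C, hC⟩ := h.exists_norm_mul_fourier_le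
    refine ⟨2 * C, fun ξ => ?_⟩
    rw [norm_mul, Complex.norm_ofNat]
    exact mul_le_mul_of_nonneg_left (hC ξ) zero_le_two

lemma memLp_posFreqDeriv (h : IsRegularDensity ρ) : MemLp (posFreqDeriv ρ) 2 :=
  (h.memLp_mul_fourier.const_mul 2).indicator measurableSet_Ioi

lemma memLp_hardyPart (h : IsRegularDensity ρ) : MemLp (hardyPart ρ) 2 :=
  memLp_fourierInv h.isHardySymbol_posFreq.integrable
    (((memLp_fourier h.integrable h.memLp).const_mul 2).indicator measurableSet_Ioi)

lemma memLp_hardyDeriv (h : IsRegularDensity ρ) : MemLp (hardyDeriv ρ) 2 :=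
  memLp_fourierInv h.isHardySymbol_posFreqDeriv.integrable h.memLp_posFreqDeriv

lemma continuous_hardyPart (h : IsRegularDensity ρ) : Continuous (hardyPart ρ) :=
  continuous_fourierInv h.isHardySymbol_posFreq.integrable

lemma continuous_hardyDeriv (h : IsRegularDensity ρ) : Continuous (hardyDeriv ρ) :=
  continuous_fourierInv h.isHardySymbol_posFreqDeriv.integrable

lemma hardyPart_add_conj (h : IsRegularDensity ρ) (x : ℝ) :
    hardyPart ρ x + conj (hardyPart ρ x) = 2 * ρ x := by
  have hi : Integrable fun ξ => conj (posFreq ρ (-ξ)) :=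
    Complex.conjCLE.toContinuousLinearMap.integrable_comp
      h.isHardySymbol_posFreq.integrable.comp_neg
  have h𝓕 : (fun ξ => posFreq ρ ξ + conj (posFreq ρ (-ξ))) =ᵐ[volume]
      fun ξ => 2 * 𝓕 ρ ξ := by
    filter_upwards [Measure.ae_ne volume 0] with ξ hξ
    obtain hξ | hξ := hξ.lt_or_gt
    · rw [h.isHardySymbol_posFreq.eq_zero ξ hξ.le, posFreq,
        indicator_of_mem (mem_Ioi.2 (neg_pos.2 hξ)), h.fourier_neg, map_mul, Complex.conj_conj,
        zero_add, Complex.conj_ofNat]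
    · rw [h.isHardySymbol_posFreq.eq_zero (-ξ) (neg_nonpos.2 hξ.le), posFreq,
        indicator_of_mem (mem_Ioi.2 hξ), map_zero, add_zero]
  rw [hardyPart, conj_fourierInv, ← fourierInv_add h.isHardySymbol_posFreq.integrable hi,
    Real.fourierInv_congr_ae h𝓕, fourierInv_const_mul, h.fourierInv_fourier]

lemma hardyPart_re (h : IsRegularDensity ρ) (x : ℝ) : (hardyPart ρ x).re = (ρ x).re := by
  have hadd := h.hardyPart_add_conj x
  rw [Complex.add_conj, Complex.ofReal_mul, Complex.ofReal_ofNat] at hadd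
  rw [← mul_left_cancel₀ two_ne_zero hadd, Complex.ofReal_re]

lemma hasDerivAt_hardyPart (h : IsRegularDensity ρ) (x : ℝ) :
    HasDerivAt (hardyPart ρ) (hardyDeriv ρ x) x := by
  have hi : Integrable fun ξ : ℝ => ξ • posFreq ρ ξ := by
    refine (h.isHardySymbol_posFreqDeriv.integrable.const_mul (2 * π * I)⁻¹).congr
      (ae_of_all _ fun ξ => ?_)
    beta_reduce
    rw [posFreqDeriv_eq, mul_assoc _ (ξ : ℂ), inv_mul_cancel_left₀ Complex.two_pi_I_ne_zero,
      Complex.real_smul]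
  have hd := (Real.hasDerivAt_fourier h.isHardySymbol_posFreq.integrable hi (-x)).scomp x
    (hasDerivAt_neg x)
  refine (hd.congr_of_eventuallyEq (Eventually.of_forall fun y =>
    Real.fourierInv_eq_fourier_neg _ _)).congr_deriv ?_
  rw [hardyDeriv, Real.fourierInv_eq_fourier_neg, fourier_eq_integral_exp_mul,
    fourier_eq_integral_exp_mul, neg_smul, one_smul, ← integral_neg]
  congr 1 with ξ
  rw [posFreqDeriv_eq, smul_eq_mul]
  ring

lemma hardyDeriv_add_conj (h : IsRegularDensity ρ) {ρ' : ℂ} {x : ℝ} (hρ : HasDerivAt ρ ρ' x) :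
    hardyDeriv ρ x + conj (hardyDeriv ρ x) = 2 * ρ' := by
  have hF := h.hasDerivAt_hardyPart x
  refine (hF.add hF.star).unique ((hρ.const_mul 2).congr_of_eventuallyEq ?_)
  exact Eventually.of_forall h.hardyPart_add_conj

/-- In terms of `Π₊`, the nonlocal term of the equation is `(D + |D|) ρ = -i ∂ₓ (2 Π₊ ρ)`. -/
lemma dAddAbsD_ae_eq (h : IsRegularDensity ρ) :
    DAddAbsD ρ =ᵐ[volume] fun x => -I * hardyDeriv ρ x := by
  have hsymbol : (fun ξ : ℝ => ((2 * π * ξ + |2 * π * ξ| : ℝ) : ℂ) *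
      (𝓕 (h.memLp.toLp ρ : Lp ℂ 2 (volume : Measure ℝ)) : Lp ℂ 2 volume) ξ) =ᵐ[volume]
      fun ξ => -I * posFreqDeriv ρ ξ := by
    filter_upwards [lpFourier_toLp_ae_eq h.integrable h.memLp] with ξ hξ
    rw [hξ]
    obtain h0 | h0 := lt_or_ge 0 ξ
    · rw [abs_of_pos (mul_pos Real.two_pi_pos h0), posFreqDeriv, indicator_of_mem (mem_Ioi.2 h0)]
      push_cast
      linear_combination (4 * π * ξ * 𝓕 ρ ξ) * Complex.I_sq
    · rw [abs_of_nonpos (mul_nonpos_of_nonneg_of_nonpos Real.two_pi_pos.le h0), add_neg_cancel,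
        h.isHardySymbol_posFreqDeriv.eq_zero ξ h0, Complex.ofReal_zero, zero_mul, mul_zero]
  have hL : MemLp (fun ξ => -I * posFreqDeriv ρ ξ) 2 volume :=
    h.memLp_posFreqDeriv.const_mul _
  have hL' := (memLp_congr_ae hsymbol).2 hL
  rw [DAddAbsD, dif_pos h.memLp, multiplier, dif_pos hL', (MemLp.toLp_eq_toLp_iff hL' hL).2 hsymbol]
  refine (lpFourierInv_toLp_ae_eq (h.isHardySymbol_posFreqDeriv.integrable.const_mul _) hL).trans
    (ae_of_all _ fun x => fourierInv_const_mul _ _ _)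

lemma integrable_hardyPart_cube (h : IsRegularDensity ρ) :
    Integrable fun x => hardyPart ρ x ^ 3 := by
  simp only [pow_succ, pow_zero, one_mul]
  exact (h.memLp_hardyPart.integrable_mul h.memLp_hardyPart).mul_bdd
    h.continuous_hardyPart.aestronglyMeasurable (ae_of_all _ (norm_fourierInv_le _))

lemma integral_hardyPart_cube (h : IsRegularDensity ρ) : ∫ x, hardyPart ρ x ^ 3 = 0 := by
  have ha := h.isHardySymbol_posFreq
  have hcube : (fun x => hardyPart ρ x ^ 3) = fun x =>
      𝓕⁻ (posFreq ρ) x * 𝓕⁻ (posFreq ρ ⋆[ContinuousLinearMap.mul ℂ ℂ] posFreq ρ) x := by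
    ext x
    rw [fourierInv_convolution ha.integrable ha.integrable, hardyPart]
    ring
  rw [hcube]
  exact ha.integral_mul_eq_zero (ha.convolution ha) (hcube ▸ h.integrable_hardyPart_cube)

lemma integrable_hardyDeriv_sq (h : IsRegularDensity ρ) :
    Integrable fun x => hardyDeriv ρ x ^ 2 := by
  simp only [sq]
  exact h.memLp_hardyDeriv.integrable_mul h.memLp_hardyDeriv

lemma fourier_hardyDeriv_sq (h : IsRegularDensity ρ) :
    𝓕 (fun x => hardyDeriv ρ x ^ 2) =
      posFreqDeriv ρ ⋆[ContinuousLinearMap.mul ℂ ℂ] posFreqDeriv ρ := by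
  have hi := h.integrable_hardyDeriv_sq
  simp only [sq] at hi ⊢
  exact h.isHardySymbol_posFreqDeriv.fourier_mul_eq h.isHardySymbol_posFreqDeriv hi

lemma fourier_hardyDeriv_sq_of_nonpos (h : IsRegularDensity ρ) {ξ : ℝ} (hξ : ξ ≤ 0) :
    𝓕 (fun x => hardyDeriv ρ x ^ 2) ξ = 0 := by
  rw [h.fourier_hardyDeriv_sq]
  exact (h.isHardySymbol_posFreqDeriv.convolution h.isHardySymbol_posFreqDeriv).eq_zero ξ hξ

lemma exists_norm_fourier_hardyDeriv_sq_le (h : IsRegularDensity ρ) :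
    ∃ C, ∀ ξ : ℝ, 0 ≤ ξ → ‖𝓕 (fun x => hardyDeriv ρ x ^ 2) ξ‖ ≤ C * ξ ^ 3 := by
  obtain ⟨A, hA⟩ := h.isHardySymbol_posFreq.exists_norm_le
  have hderiv : ∀ ξ : ℝ, 0 < ξ → ‖posFreqDeriv ρ ξ‖ ≤ 2 * π * A * ξ := fun ξ hξ => by
    rw [posFreqDeriv_eq, norm_mul, norm_mul, norm_mul, norm_mul, Complex.norm_ofNat,
      Complex.norm_real, Complex.norm_real, Complex.norm_I, Real.norm_of_nonneg Real.pi_pos.le,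
      Real.norm_of_nonneg hξ.le, mul_one, mul_right_comm _ A]
    gcongr
    exact hA ξ
  rw [h.fourier_hardyDeriv_sq]
  have h0 := h.isHardySymbol_posFreqDeriv.eq_zero
  exact ⟨_, fun ξ hξ => norm_convolution_le_mul_pow_three h0 h0 hderiv hderiv hξ⟩

lemma hardyDeriv_eq_of_re_eq (h : IsRegularDensity ρ)
    (hre : ∀ x, (hardyDeriv ρ x).re = (I / 2 * hardyPart ρ x ^ 2).re) (x : ℝ) :
    hardyDeriv ρ x = I / 2 * hardyPart ρ x ^ 2 := by
  have ha := h.isHardySymbol_posFreq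
  have hb := (ha.convolution ha).const_mul (-(I / 2))
  have hab := h.isHardySymbol_posFreqDeriv.add hb
  have h𝓕 : ∀ x, 𝓕⁻ (fun ξ => posFreqDeriv ρ ξ + -(I / 2) *
      (posFreq ρ ⋆[ContinuousLinearMap.mul ℂ ℂ] posFreq ρ) ξ) x =
      hardyDeriv ρ x - I / 2 * hardyPart ρ x ^ 2 := fun x => by
    rw [fourierInv_add h.isHardySymbol_posFreqDeriv.integrable hb.integrable, fourierInv_const_mul,
      fourierInv_convolution ha.integrable ha.integrable, hardyDeriv, hardyPart]
    ring
  refine sub_eq_zero.1 ((h𝓕 x).symm.trans (hab.fourierInv_eq_zero_of_re_eq_zero (fun x => ?_) x))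
  rw [h𝓕, Complex.sub_re, hre, sub_self]

end IsRegularDensity

/-! ### Profiles -/

/-- The density `|Q|²`, as a complex-valued function. -/
noncomputable def density (Q : ℝ → ℂ) (x : ℝ) : ℂ := Q x * conj (Q x)

lemma density_eq (Q : ℝ → ℂ) (x : ℝ) : density Q x = ((‖Q x‖ ^ 2 : ℝ) : ℂ) := by
  rw [density, Complex.mul_conj, Complex.normSq_eq_norm_sq]

lemma isRegularDensity_density {Q q h : ℝ → ℂ} (hQ : IsPrimitive Q q) (hq : IsPrimitive q h)
    (hQ2 : MemLp Q 2) (hq2 : MemLp q 2) (hh2 : MemLp h 2) : IsRegularDensity (density Q) := by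
  have hρ : IsPrimitive (density Q) fun x => q x * conj (Q x) + Q x * conj (q x) := hQ.mul hQ.star
  have hρ' := (hq.mul hQ.star).add (hQ.mul hq.star)
  have hmulQ : ∀ {f : ℝ → ℂ}, MemLp f 2 → MemLp (fun x => f x * conj (Q x)) 2 := fun hf => by
    obtain ⟨C, hC⟩ := hQ.star.exists_norm_le_of_memLp hQ2.star hq2.star
    exact (memLp_top_of_bound hQ.star.continuous.aestronglyMeasurable C (ae_of_all _ hC)).mul hf
  have hmulq : ∀ {f : ℝ → ℂ}, MemLp f 2 → MemLp (fun x => f x * conj (q x)) 2 := fun hf => by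
    obtain ⟨C, hC⟩ := hq.star.exists_norm_le_of_memLp hq2.star hh2.star
    exact (memLp_top_of_bound hq.star.continuous.aestronglyMeasurable C (ae_of_all _ hC)).mul hf
  have hQh : MemLp (fun x => Q x * conj (h x)) 2 := by
    simpa only [Pi.star_def, RCLike.star_def, map_mul, Complex.conj_conj, mul_comm]
      using (hmulQ hh2).star
  have hi := hQ2.integrable_mul hQ2.star
  have hi' := (hq2.integrable_mul hQ2.star).add (hQ2.integrable_mul hq2.star)
  have hi'' := ((hh2.integrable_mul hQ2.star).add (hq2.integrable_mul hq2.star)).add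
    ((hq2.integrable_mul hq2.star).add (hQ2.integrable_mul hh2.star))
  refine ⟨hρ.continuous, fun x => ?_, hi, hmulQ hQ2, _, hi.sub hi'',
    (hmulQ hQ2).sub (((hmulQ hh2).add (hmulq hq2)).add ((hmulq hq2).add hQh)), fun ξ => ?_⟩
  · rw [density_eq, Complex.conj_ofReal]
  · have h1 := hρ.fourier_eq hi hi' ξ
    have h2 := hρ'.fourier_eq hi' hi'' ξ
    refine Eq.trans ?_ (fourier_sub hi hi'' ξ).symm
    change _ = 𝓕 (density Q) ξ - 𝓕 (fun x => h x * conj (Q x) + q x * conj (q x) +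
      (q x * conj (q x) + Q x * conj (h x))) ξ
    linear_combination h2 + 2 * π * I * ξ * h1 + (2 * π * ξ) ^ 2 * 𝓕 (density Q) ξ * Complex.I_sq

/-- `Q` is a classical solution with derivative `q` of the stationary equation
`Q'' + (D + |D|)(|Q|²) Q = μ Q`, in which `(D + |D|)(|Q|²)` is written as `-i ∂ₓ (2 Π₊ |Q|²)`. -/
structure IsProfile (μ : ℝ) (Q q : ℝ → ℂ) : Prop where
  hasDerivAt : ∀ x, HasDerivAt Q (q x) x
  hasDerivAt_deriv : ∀ x, HasDerivAt q (μ * Q x + I * hardyDeriv (density Q) x * Q x) x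
  memLp : MemLp Q 2
  memLp_deriv : MemLp q 2
  isRegularDensity : IsRegularDensity (density Q)

lemma eq_zero_of_hasDerivAt_zero {f : ℝ → ℂ} (hf : ∀ x, HasDerivAt f 0 x) (hi : Integrable f)
    (x : ℝ) : f x = 0 := by
  have hconst : f = fun _ => f x := funext fun y =>
    is_const_of_deriv_eq_zero (fun z => (hf z).differentiableAt) (fun z => (hf z).deriv) y x
  rw [hconst, integrable_const_iff] at hi
  exact hi.resolve_right fun h => (measure_lt_top volume univ).ne Real.volume_univ

namespace IsProfile

variable {μ : ℝ} {Q q : ℝ → ℂ}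

lemma of_isPrimitive (hQ : IsPrimitive Q q)
    (hq : IsPrimitive q fun x => μ * Q x - DAddAbsD (fun z => ((‖Q z‖ ^ 2 : ℝ) : ℂ)) x * Q x)
    (hQ2 : MemLp Q 2) (hq2 : MemLp q 2) : IsProfile μ Q q := by
  simp only [← density_eq] at hq
  obtain ⟨C, hC⟩ := hQ.exists_norm_le_of_memLp hQ2 hq2
  have hQb : MemLp Q ⊤ := memLp_top_of_bound hQ.continuous.aestronglyMeasurable C (ae_of_all _ hC)
  have hr := isRegularDensity_density hQ hq hQ2 hq2
    ((hQ2.const_mul (μ : ℂ)).sub (hQb.mul (Lp.memLp (DAddAbsD fun z => density Q z))))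
  have hq' : IsPrimitive q fun x => μ * Q x + I * hardyDeriv (density Q) x * Q x := by
    refine hq.congr_ae (hr.dAddAbsD_ae_eq.mono fun x hx => ?_)
    simp only [hx]
    ring
  refine ⟨hQ.hasDerivAt hq.continuous, hq'.hasDerivAt ?_, hQ2, hq2, hr⟩
  have := hQ.continuous
  have := hr.continuous_hardyDeriv
  fun_prop

lemma continuous (h : IsProfile μ Q q) : Continuous Q :=
  continuous_iff_continuousAt.2 fun x => (h.hasDerivAt x).continuousAt

lemma continuous_deriv (h : IsProfile μ Q q) : Continuous q :=
  continuous_iff_continuousAt.2 fun x => (h.hasDerivAt_deriv x).continuousAt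

lemma hasDerivAt_density (h : IsProfile μ Q q) (x : ℝ) :
    HasDerivAt (density Q) (q x * conj (Q x) + Q x * conj (q x)) x :=
  (h.hasDerivAt x).mul (h.hasDerivAt x).star

lemma integrable_density_sq (h : IsProfile μ Q q) : Integrable fun x => density Q x ^ 2 := by
  simp only [sq]
  exact h.isRegularDensity.memLp.integrable_mul h.isRegularDensity.memLp

lemma integrable_density_cube (h : IsProfile μ Q q) : Integrable fun x => density Q x ^ 3 := by
  obtain ⟨C, hC⟩ := h.isRegularDensity.exists_norm_le
  simp only [pow_succ _ 2]
  exact h.integrable_density_sq.mul_bdd h.isRegularDensity.continuous.aestronglyMeasurable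
    (ae_of_all _ hC)

lemma current_eq (h : IsProfile μ Q q) (x : ℝ) :
    conj (Q x) * q x - Q x * conj (q x) = I * density Q x ^ 2 := by
  refine sub_eq_zero.1 (eq_zero_of_hasDerivAt_zero (f := fun x =>
    conj (Q x) * q x - Q x * conj (q x) - I * density Q x ^ 2) (fun x => ?_) ?_ x)
  · have hQ := h.hasDerivAt x
    have hq := h.hasDerivAt_deriv x
    have hF := h.isRegularDensity.hardyDeriv_add_conj (h.hasDerivAt_density x)
    refine (((hQ.star.mul hq).sub (hQ.mul hq.star)).sub
      (((h.hasDerivAt_density x).pow 2).const_mul I)).congr_deriv ?_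
    simp only [RCLike.star_def, map_add, map_mul, Complex.conj_I, Complex.conj_ofReal, density]
    linear_combination (I * Q x * conj (Q x)) * hF
  · exact ((h.memLp.star.integrable_mul h.memLp_deriv).sub
      (h.memLp.integrable_mul h.memLp_deriv.star)).sub (h.integrable_density_sq.const_mul I)

/-- The spatial flux of the momentum of the standing wave with profile `Q`. -/
noncomputable def momentumFlux (μ : ℝ) (Q q : ℝ → ℂ) (x : ℝ) : ℂ :=
  q x * conj (q x) - density Q x ^ 3 / 3 - μ * density Q x

lemma integrable_momentumFlux (h : IsProfile μ Q q) : Integrable (momentumFlux μ Q q) :=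
  ((h.memLp_deriv.integrable_mul h.memLp_deriv.star).sub
    (h.integrable_density_cube.div_const 3)).sub (h.isRegularDensity.integrable.const_mul _)

lemma hasDerivAt_momentumFlux (h : IsProfile μ Q q) (x : ℝ) :
    HasDerivAt (momentumFlux μ Q q)
      (I / 4 * (hardyDeriv (density Q) x ^ 2 - conj (hardyDeriv (density Q) x ^ 2))) x := by
  have hq := h.hasDerivAt_deriv x
  have hρ := h.hasDerivAt_density x
  refine (((hq.mul hq.star).sub ((hρ.pow 3).div_const 3)).sub
    (hρ.const_mul (μ : ℂ))).congr_deriv ?_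
  have hJ := h.current_eq x
  have hF := h.isRegularDensity.hardyDeriv_add_conj hρ
  rw [density] at hJ
  simp only [RCLike.star_def, map_add, map_mul, map_pow, Complex.conj_I, Complex.conj_ofReal]
  generalize hardyDeriv (density Q) x = F at hF
  rw [density]
  linear_combination (-I / 2 * (F + conj F)) * hJ + (-I / 4 * (F - conj F)) * hF +
    ((Q x * conj (Q x)) ^ 2 * (-1 / 2) * (F + conj F)) * Complex.I_sq +
    ((Q x * conj (Q x)) ^ 2 / 2) * hF

lemma fourier_momentumFlux (h : IsProfile μ Q q) {ξ : ℝ} (hξ : 0 < ξ) :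
    2 * π * I * ξ * 𝓕 (momentumFlux μ Q q) ξ =
      I / 4 * 𝓕 (fun x => hardyDeriv (density Q) x ^ 2) ξ := by
  have hr := h.isRegularDensity
  have hi := hr.integrable_hardyDeriv_sq
  have hconj : Integrable fun x => conj (hardyDeriv (density Q) x ^ 2) :=
    Complex.conjCLE.toContinuousLinearMap.integrable_comp hi
  have hS : IsPrimitive (momentumFlux μ Q q) _ := IsPrimitive.of_hasDerivAt
    h.hasDerivAt_momentumFlux (by have := hr.continuous_hardyDeriv; fun_prop)
  rw [← hS.fourier_eq h.integrable_momentumFlux ((hi.sub hconj).const_mul _), fourier_const_mul,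
    fourier_sub hi hconj, fourier_conj,
    hr.fourier_hardyDeriv_sq_of_nonpos (neg_nonpos.2 hξ.le), map_zero, sub_zero]

lemma integral_momentumFlux (h : IsProfile μ Q q) : ∫ x, momentumFlux μ Q q x = 0 := by
  obtain ⟨C, hC⟩ := h.isRegularDensity.exists_norm_fourier_hardyDeriv_sq_le
  refine integral_eq_zero_of_norm_fourier_le h.integrable_momentumFlux (C := C / (8 * π))
    fun ξ hξ => ?_
  have hnorm := congrArg norm (h.fourier_momentumFlux hξ)
  simp only [norm_mul, norm_div, Complex.norm_I, Complex.norm_ofNat, Complex.norm_real,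
    Real.norm_of_nonneg Real.pi_pos.le, Real.norm_of_nonneg hξ.le, mul_one] at hnorm
  have hbound := hC ξ hξ.le
  rw [div_mul_eq_mul_div, le_div_iff₀ (by positivity)]
  refine le_of_mul_le_mul_left ?_ hξ
  linarith

/-- Up to total derivatives, this writes the energy density as a complete square. -/
lemma norm_deriv_sub_sq (h : IsProfile μ Q q) (x : ℝ) :
    ‖q x - I / 2 * hardyPart (density Q) x * Q x‖ ^ 2 = (1 / 2 * momentumFlux μ Q q x +
      1 / 2 * ((μ * Q x + I * hardyDeriv (density Q) x * Q x) * conj (Q x) + q x * conj (q x)) -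
      I / 2 * (hardyDeriv (density Q) x * density Q x +
        hardyPart (density Q) x * (q x * conj (Q x) + Q x * conj (q x))) -
      1 / 12 * hardyPart (density Q) x ^ 3).re := by
  have hJ := h.current_eq x
  have hF := h.isRegularDensity.hardyPart_add_conj x
  apply Complex.ofReal_injective
  rw [← Complex.normSq_eq_norm_sq, ← Complex.mul_conj, Complex.re_eq_add_conj]
  simp only [momentumFlux]
  generalize hardyPart (density Q) x = F at hF
  generalize hardyDeriv (density Q) x = G
  simp only [density, map_sub, map_add, map_mul, map_pow, map_div₀, map_one,
    Complex.conj_I, Complex.conj_ofReal, Complex.conj_conj, Complex.conj_ofNat] at hF hJ ⊢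
  rw [eq_sub_of_add_eq' hF]
  linear_combination (I / 2 * (Q x * conj (Q x))) * hJ +
    (- (Q x * conj (Q x)) * (2 * (Q x * conj (Q x)) - F) * F / 4 +
      (Q x * conj (Q x)) ^ 3 / 2) * Complex.I_sq

lemma hasDerivAt_deriv_mul_conj (h : IsProfile μ Q q) (x : ℝ) :
    HasDerivAt (fun x => q x * conj (Q x))
      ((μ * Q x + I * hardyDeriv (density Q) x * Q x) * conj (Q x) + q x * conj (q x)) x :=
  (h.hasDerivAt_deriv x).mul (h.hasDerivAt x).star

lemma integrable_hasDerivAt_deriv_mul_conj (h : IsProfile μ Q q) :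
    Integrable fun x =>
      (μ * Q x + I * hardyDeriv (density Q) x * Q x) * conj (Q x) + q x * conj (q x) := by
  have hr := h.isRegularDensity
  refine (((hr.integrable.const_mul (μ : ℂ)).add
    ((hr.memLp_hardyDeriv.integrable_mul hr.memLp).const_mul I)).add
    (h.memLp_deriv.integrable_mul h.memLp_deriv.star)).congr (ae_of_all _ fun x => ?_)
  simp only [Pi.add_apply, Pi.mul_apply, Pi.star_apply, RCLike.star_def, density]
  ring

lemma integrable_hasDerivAt_hardyPart_mul_density (h : IsProfile μ Q q) :
    Integrable fun x => hardyDeriv (density Q) x * density Q x +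
      hardyPart (density Q) x * (q x * conj (Q x) + Q x * conj (q x)) := by
  have hr := h.isRegularDensity
  refine (hr.memLp_hardyDeriv.integrable_mul hr.memLp).add (Integrable.bdd_mul
    ((h.memLp_deriv.integrable_mul h.memLp.star).add (h.memLp.integrable_mul h.memLp_deriv.star))
    hr.continuous_hardyPart.aestronglyMeasurable
    (ae_of_all _ (norm_fourierInv_le (posFreq (density Q)))))

/-- The integral of the energy density vanishes, and `norm_deriv_sub_sq` makes it a square. -/
lemma deriv_eq (h : IsProfile μ Q q) (x : ℝ) :
    q x = I / 2 * hardyPart (density Q) x * Q x := by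
  have hr := h.isRegularDensity
  have hS := h.integrable_momentumFlux.const_mul (1 / 2)
  have hT := h.integrable_hasDerivAt_deriv_mul_conj
  have hW := h.integrable_hasDerivAt_hardyPart_mul_density
  have hF := hr.integrable_hardyPart_cube.const_mul (1 / 12)
  have hT0 := integral_eq_zero_of_hasDerivAt_of_integrable h.hasDerivAt_deriv_mul_conj hT
    (h.memLp_deriv.integrable_mul h.memLp.star)
  have hW0 := integral_eq_zero_of_hasDerivAt_of_integrable
    (fun x => (hr.hasDerivAt_hardyPart x).mul (h.hasDerivAt_density x)) hW
    (hr.memLp_hardyPart.integrable_mul hr.memLp)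
  have hi := ((hS.add (hT.const_mul (1 / 2))).sub (hW.const_mul (I / 2))).sub hF
  set A : ℝ → ℂ := fun x => q x - I / 2 * hardyPart (density Q) x * Q x
  have hA : Continuous A := by
    have := h.continuous
    have := h.continuous_deriv
    have := hr.continuous_hardyPart
    fun_prop
  have hre : ∀ x, ‖A x‖ ^ 2 = _ := h.norm_deriv_sub_sq
  have hiA : Integrable fun x => ‖A x‖ ^ 2 := by
    simpa only [hre] using! hi.re
  have hA0 : ∫ x, ‖A x‖ ^ 2 = 0 := by
    simp only [hre]
    refine (integral_re hi).trans ?_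
    rw [integral_sub' ((hS.add (hT.const_mul _)).sub (hW.const_mul _)) hF,
      integral_sub' (hS.add (hT.const_mul _)) (hW.const_mul _), integral_add' hS (hT.const_mul _),
      integral_const_mul, integral_const_mul, integral_const_mul, integral_const_mul,
      h.integral_momentumFlux, hT0, hW0, hr.integral_hardyPart_cube]
    simp only [mul_zero, add_zero, sub_zero, map_zero]
  have hae := (integral_eq_zero_iff_of_nonneg (fun x => by positivity) hiA).1 hA0
  have hsq := (Continuous.ae_eq_iff_eq volume (hA.norm.pow 2) continuous_const).1 hae
  exact sub_eq_zero.1 (norm_eq_zero.1 (pow_eq_zero_iff two_ne_zero |>.1 (congrFun hsq x)))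

lemma hardyDeriv_eq (h : IsProfile μ Q q) (x : ℝ) :
    hardyDeriv (density Q) x = I / 2 * hardyPart (density Q) x ^ 2 := by
  have hr := h.isRegularDensity
  refine hr.hardyDeriv_eq_of_re_eq (fun x => ?_) x
  have hF := hr.hardyPart_add_conj x
  have hF' := hr.hardyDeriv_add_conj (h.hasDerivAt_density x)
  have hq := h.deriv_eq x
  apply Complex.ofReal_injective
  simp only [Complex.re_eq_add_conj]
  rw [hF', hq]
  simp only [map_mul, map_div₀, map_pow, Complex.conj_I, Complex.conj_ofNat]
  generalize hardyPart (density Q) x = F at hF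
  rw [density] at hF
  linear_combination (-I / 4 * (F - conj F)) * hF

end IsProfile

/-! ### Integration of the first-order system -/

lemma eq_zero_of_hasDerivAt_mul {W a : ℝ → ℂ} (ha : Continuous a)
    (hW : ∀ x, HasDerivAt W (a x * W x) x) {x₀ : ℝ} (h₀ : W x₀ = 0) (x : ℝ) : W x = 0 := by
  have hd : ∀ x, HasDerivAt (fun x => W x * Complex.exp (-∫ t in x₀..x, a t)) 0 x := fun x =>
    ((hW x).mul (ha.integral_hasStrictDerivAt x₀ x).hasDerivAt.neg.cexp).congr_deriv (by ring)
  have hc := is_const_of_deriv_eq_zero (fun x => (hd x).differentiableAt)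
    (fun x => (hd x).deriv) x x₀
  simp only [h₀, zero_mul] at hc
  exact (mul_eq_zero.1 hc).resolve_right (Complex.exp_ne_zero _)

lemma hasDerivAt_one_sub_mul (a : ℂ) (x₀ x : ℝ) :
    HasDerivAt (fun x : ℝ => 1 - a * ((x : ℂ) - x₀)) (-a) x := by
  simpa only [mul_one, id_eq] using
    (((hasDerivAt_id (x : ℂ)).comp_ofReal.sub_const (x₀ : ℂ)).const_mul a).const_sub 1

lemma riccati_mul_eq {F : ℝ → ℂ} {a : ℂ} (hF : ∀ x, HasDerivAt F (a * F x ^ 2) x) (x₀ x : ℝ) :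
    F x * (1 - a * F x₀ * (x - x₀)) = F x₀ := by
  have hFc : Continuous F := continuous_iff_continuousAt.2 fun x => (hF x).continuousAt
  refine sub_eq_zero.1 (eq_zero_of_hasDerivAt_mul (a := fun x => a * F x)
    (W := fun x : ℝ => F x * (1 - a * F x₀ * (x - x₀)) - F x₀) (x₀ := x₀)
    (by fun_prop) (fun x => ?_) (by ring) x)
  exact (((hF x).mul (hasDerivAt_one_sub_mul _ x₀ x)).sub_const _).congr_deriv (by ring)

lemma mul_eq_of_hasDerivAt_riccati {F Q : ℝ → ℂ} {a : ℂ}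
    (hF : ∀ x, HasDerivAt F (a * F x ^ 2) x) (hQ : ∀ x, HasDerivAt Q (a * F x * Q x) x)
    (x₀ x : ℝ) : Q x * (1 - a * F x₀ * (x - x₀)) = Q x₀ := by
  have hd : ∀ x : ℝ, HasDerivAt (fun x : ℝ => Q x * (1 - a * F x₀ * (x - x₀))) 0 x := fun x => by
    refine ((hQ x).mul (hasDerivAt_one_sub_mul _ x₀ x)).congr_deriv ?_
    linear_combination (a * Q x) * riccati_mul_eq hF x₀ x
  have hc := is_const_of_deriv_eq_zero (fun x => (hd x).differentiableAt)
    (fun x => (hd x).deriv) x x₀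
  simpa only [sub_self, mul_zero, sub_zero, mul_one] using hc

namespace IsProfile

variable {μ : ℝ} {Q q : ℝ → ℂ}

lemma hasDerivAt_hardyPart (h : IsProfile μ Q q) (x : ℝ) :
    HasDerivAt (hardyPart (density Q)) (I / 2 * hardyPart (density Q) x ^ 2) x := by
  rw [← h.hardyDeriv_eq]
  exact h.isRegularDensity.hasDerivAt_hardyPart x

lemma hasDerivAt_hardyPart_mul (h : IsProfile μ Q q) (x : ℝ) :
    HasDerivAt Q (I / 2 * hardyPart (density Q) x * Q x) x := by
  rw [← h.deriv_eq]
  exact h.hasDerivAt x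

lemma eigenvalue_eq_zero (h : IsProfile μ Q q) {x₀ : ℝ} (hx₀ : Q x₀ ≠ 0) : μ = 0 := by
  have hq := ((h.hasDerivAt_hardyPart x₀).const_mul (I / 2)).mul (h.hasDerivAt_hardyPart_mul x₀)
  have heq := (h.hasDerivAt_deriv x₀).unique
    (hq.congr_of_eventuallyEq (Eventually.of_forall h.deriv_eq))
  rw [h.hardyDeriv_eq] at heq
  have hμ : (μ : ℂ) * Q x₀ = 0 := by linear_combination heq
  exact Complex.ofReal_eq_zero.1 ((mul_eq_zero.1 hμ).resolve_right hx₀)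

lemma exists_eq_div (h : IsProfile μ Q q) {x₀ : ℝ} (hx₀ : Q x₀ ≠ 0) :
    ∃ κ c : ℂ, 0 < c.im ∧ ‖κ‖ ^ 2 = 2 * c.im ∧ ∀ x : ℝ, Q x = κ / (x + c) := by
  set F := hardyPart (density Q)
  have hre : (F x₀).re = ‖Q x₀‖ ^ 2 := by
    rw [h.isRegularDensity.hardyPart_re, density_eq, Complex.ofReal_re]
  have hQpos : 0 < ‖Q x₀‖ := norm_pos_iff.2 hx₀
  have hF₀ : F x₀ ≠ 0 := fun h₀ => by
    rw [h₀, Complex.zero_re] at hre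
    exact (pow_pos hQpos 2).ne hre
  have : 0 < ‖F x₀‖ := norm_pos_iff.2 hF₀
  have him : (-(x₀ : ℂ) + 2 * I / F x₀).im = 2 * (F x₀).re / ‖F x₀‖ ^ 2 := by
    rw [← Complex.normSq_eq_norm_sq]
    simp [Complex.div_im]
  refine ⟨2 * I * Q x₀ / F x₀, -x₀ + 2 * I / F x₀, ?_, ?_, fun x => ?_⟩
  · rw [him, hre]
    positivity
  · rw [him, hre]
    simp only [norm_div, norm_mul, Complex.norm_I, Complex.norm_ofNat]
    field_simp
  · have hFx := riccati_mul_eq h.hasDerivAt_hardyPart x₀ x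
    have hQx := mul_eq_of_hasDerivAt_riccati h.hasDerivAt_hardyPart h.hasDerivAt_hardyPart_mul x₀ x
    have hne : 1 - I / 2 * F x₀ * ((x : ℂ) - x₀) ≠ 0 :=
      right_ne_zero_of_mul (ne_of_eq_of_ne hFx hF₀)
    have hden : (x : ℂ) + (-x₀ + 2 * I / F x₀) =
        2 * I / F x₀ * (1 - I / 2 * F x₀ * ((x : ℂ) - x₀)) := by
      field_simp
      linear_combination (F x₀ * (x - x₀)) * Complex.I_sq
    rw [hden, eq_div_iff (mul_ne_zero (div_ne_zero (by simp) hF₀) hne)]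
    linear_combination (2 * I / F x₀) * hQx

end IsProfile

/-! ### Solitons -/

/-- The soliton with velocity `v`, amplitude `κ` and pole `-c`. -/
noncomputable def soliton (v : ℝ) (κ c : ℂ) (x : ℝ) : ℂ :=
  Complex.exp (I / 2 * v * x) * (κ / (x + c))

/-- `f` agrees almost everywhere with a soliton of velocity `v` that has its pole in the lower
half-plane and the critical mass, `π ‖κ‖² / im c = 2π`. -/
def IsSoliton (v : ℝ) (f : ℝ → ℂ) : Prop :=
  ∃ κ c : ℂ, 0 < c.im ∧ ‖κ‖ ^ 2 = 2 * c.im ∧ f =ᵐ[volume] soliton v κ c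

lemma re_two_pi_mul_I_mul_neg {c : ℂ} (hc : 0 < c.im) : (2 * π * I * c).re < 0 := by
  have hre : (2 * π * I * c).re = -(2 * π * c.im) := by simp
  rw [hre, neg_lt_zero]
  exact mul_pos Real.two_pi_pos hc

lemma ofReal_add_ne_zero {c : ℂ} (hc : 0 < c.im) (x : ℝ) : (x : ℂ) + c ≠ 0 := fun h => by
  have him := congrArg Complex.im h
  rw [Complex.add_im, Complex.ofReal_im, zero_add, Complex.zero_im] at him
  exact hc.ne' him

lemma exists_eq_norm_mul_exp (κ : ℂ) :
    ∃ θ ∈ Ico (0 : ℝ) (2 * π), κ = ‖κ‖ * Complex.exp (I * θ) := by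
  have hper : Function.Periodic (fun θ : ℝ => Complex.exp (I * θ)) (2 * π) := fun θ => by
    simp only [mul_comm I]
    push_cast
    rw [add_mul, Complex.exp_add, Complex.exp_two_pi_mul_I, mul_one]
  obtain ⟨θ, hθ, h⟩ := hper.exists_mem_Ico₀ Real.two_pi_pos κ.arg
  refine ⟨θ, hθ, ?_⟩
  rw [← h, mul_comm I, Complex.norm_mul_exp_arg_mul_I]

lemma exists_soliton_eq_groundState (v : ℝ) {κ c : ℂ} (hc : 0 < c.im) (hκ : ‖κ‖ ^ 2 = 2 * c.im) :
    ∃ θ ∈ Ico (0 : ℝ) (2 * π), ∃ lam : ℝ, 0 < lam ∧ ∃ y : ℝ, ∀ x : ℝ, soliton v κ c x =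
      Complex.exp (I / 2 * v * x) * Complex.exp (I * θ) * (√lam : ℂ) *
        groundState (lam * x + y) := by
  obtain ⟨θ, hθ, hκθ⟩ := exists_eq_norm_mul_exp κ
  refine ⟨θ, hθ, c.im⁻¹, inv_pos.2 hc, c.re / c.im, fun x => ?_⟩
  have hc' : (c.im : ℂ) ≠ 0 := Complex.ofReal_ne_zero.2 hc.ne'
  have hxc := ofReal_add_ne_zero hc x
  have hden : ((c.im⁻¹ * x + c.re / c.im : ℝ) : ℂ) + I = (x + c) / c.im := by
    push_cast
    field_simp
    rw [add_assoc, Complex.re_add_im]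
  have hnorm : √c.im⁻¹ * √2 * c.im = ‖κ‖ := by
    rw [← sq_eq_sq₀ (by positivity) (norm_nonneg κ), hκ, mul_pow, mul_pow,
      Real.sq_sqrt (inv_nonneg.2 hc.le), Real.sq_sqrt zero_le_two]
    field_simp
  rw [groundState, hden, soliton]
  conv_lhs => rw [hκθ, ← hnorm]
  push_cast
  field_simp

lemma norm_groundState_sq (x : ℝ) : ‖groundState x‖ ^ 2 = 2 * (1 + x ^ 2)⁻¹ := by
  rw [groundState, norm_div, div_pow, ← Complex.normSq_eq_norm_sq (x + I),
    ← mul_one I, ← Complex.ofReal_one, mul_comm I, Complex.normSq_add_mul_I,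
    Complex.norm_real, Real.norm_of_nonneg (Real.sqrt_nonneg 2), Real.sq_sqrt zero_le_two,
    div_eq_mul_inv, one_pow, add_comm]

lemma mass_groundState : mass groundState = 2 * π := by
  simp only [mass, norm_groundState_sq]
  rw [integral_const_mul, integral_univ_inv_one_add_sq]

/-- The Fourier transform of `soliton v κ c`. -/
noncomputable def solitonSymbol (v : ℝ) (κ c : ℂ) : ℝ → ℂ :=
  (Ioi (v / (4 * π))).indicator fun ξ =>
    -(2 * π * I) * κ * Complex.exp (-(I / 2 * v * c)) * Complex.exp (2 * π * I * c * ξ)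

section SolitonSymbol

variable {v : ℝ} {κ c : ℂ}

lemma integrable_solitonSymbol (hc : 0 < c.im) : Integrable (solitonSymbol v κ c) :=
  (integrable_indicator_iff measurableSet_Ioi).2
    ((integrableOn_exp_mul_complex_Ioi (re_two_pi_mul_I_mul_neg hc) _).const_mul _)

lemma memLp_solitonSymbol (hc : 0 < c.im) : MemLp (solitonSymbol v κ c) 2 := by
  rw [memLp_two_iff_integrable_sq_norm (integrable_solitonSymbol hc).1]
  have hc2 : 0 < (2 * c).im := by simpa using hc
  set A : ℂ := -(2 * π * I) * κ * Complex.exp (-(I / 2 * v * c))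
  refine ((integrable_indicator_iff measurableSet_Ioi).2 ((integrableOn_exp_mul_complex_Ioi
    (re_two_pi_mul_I_mul_neg hc2) (v / (4 * π))).const_mul (A ^ 2))).norm.congr
    (ae_of_all _ fun ξ => ?_)
  have hexp : 2 * π * I * (2 * c) * ξ = 2 * π * I * c * ξ + 2 * π * I * c * ξ := by ring
  by_cases h : ξ ∈ Ioi (v / (4 * π))
  · simp only [solitonSymbol, indicator_of_mem h, ← norm_pow]
    rw [hexp, Complex.exp_add]
    congr 1
    ring
  · simp only [solitonSymbol, indicator_of_notMem h, norm_zero, ne_eq, two_ne_zero,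
      not_false_eq_true, zero_pow]

lemma fourierInv_solitonSymbol (hc : 0 < c.im) (x : ℝ) :
    𝓕⁻ (solitonSymbol v κ c) x = soliton v κ c x := by
  have hxc := ofReal_add_ne_zero hc x
  have hre : (2 * π * I * (x + c)).re < 0 := re_two_pi_mul_I_mul_neg (by simpa using hc)
  have hintegrand : ∀ ξ : ℝ,
      Complex.exp (((-2 * π * ξ * -x : ℝ) : ℂ) * I) • solitonSymbol v κ c ξ =
      (Ioi (v / (4 * π))).indicator (fun ξ : ℝ => -(2 * π * I) * κ *
        Complex.exp (-(I / 2 * v * c)) * Complex.exp (2 * π * I * (x + c) * ξ)) ξ := by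
    intro ξ
    by_cases h : ξ ∈ Ioi (v / (4 * π))
    · rw [solitonSymbol, indicator_of_mem h, indicator_of_mem h, smul_eq_mul, mul_left_comm,
        ← Complex.exp_add]
      congr 2
      push_cast
      ring
    · rw [solitonSymbol, indicator_of_notMem h, indicator_of_notMem h, smul_zero]
  rw [Real.fourierInv_eq_fourier_neg, Real.fourier_real_eq_integral_exp_smul]
  simp only [hintegrand]
  rw [integral_indicator measurableSet_Ioi, integral_const_mul, integral_exp_mul_complex_Ioi hre]
  have hπ : (π : ℂ) ≠ 0 := Complex.ofReal_ne_zero.2 Real.pi_ne_zero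
  have hexp : 2 * π * I * (x + c) * ((v / (4 * π) : ℝ) : ℂ) =
      I / 2 * v * x + I / 2 * v * c := by
    push_cast
    field_simp
    ring
  rw [hexp, Complex.exp_add, Complex.exp_neg, soliton]
  have := Complex.exp_ne_zero (I / 2 * v * c)
  field_simp

lemma lpFourier_toLp_ae_eq_solitonSymbol {f : ℝ → ℂ} (hf : MemLp f 2) (hc : 0 < c.im)
    (hfs : f =ᵐ[volume] soliton v κ c) :
    (𝓕 (hf.toLp f : Lp ℂ 2 (volume : Measure ℝ)) : Lp ℂ 2 volume) =ᵐ[volume]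
      solitonSymbol v κ c := by
  have hs : MemLp (solitonSymbol v κ c) 2 := memLp_solitonSymbol hc
  have hfinv : hf.toLp f = 𝓕⁻ (hs.toLp _ : Lp ℂ 2 (volume : Measure ℝ)) := by
    refine Lp.ext (hf.coeFn_toLp.trans (hfs.trans (EventuallyEq.symm ?_)))
    exact (lpFourierInv_toLp_ae_eq (integrable_solitonSymbol hc) hs).trans
      (ae_of_all _ (fourierInv_solitonSymbol hc))
  rw [hfinv, FourierTransform.fourier_fourierInv_eq]
  exact hs.coeFn_toLp

lemma ae_solitonSymbol_eq_zero_iff (hκ : κ ≠ 0) :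
    (∀ᵐ ξ : ℝ, ξ < 0 → solitonSymbol v κ c ξ = 0) ↔ 0 ≤ v := by
  constructor
  · intro h
    by_contra! hv
    have hnull : volume (Ioo (v / (4 * π)) 0) = 0 := by
      refine measure_mono_null ?_ (ae_iff.1 h)
      intro ξ hξ hmem
      have hz := hmem hξ.2
      rw [solitonSymbol, indicator_of_mem (mem_Ioi.2 hξ.1)] at hz
      simp [Complex.exp_ne_zero, hκ, Real.pi_ne_zero] at hz
    rw [Real.volume_Ioo, ENNReal.ofReal_eq_zero, zero_sub, neg_nonpos] at hnull
    exact hnull.not_gt (div_neg_of_neg_of_pos hv (by positivity))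
  · refine fun hv => ae_of_all _ fun ξ hξ => indicator_of_notMem ?_ _
    rw [mem_Ioi, not_lt]
    exact hξ.le.trans (by positivity)

end SolitonSymbol

lemma ae_eq_comp_add {f g : ℝ → ℂ} (h : f =ᵐ[volume] g) (s : ℝ) :
    (fun x => f (x + s)) =ᵐ[volume] fun x => g (x + s) :=
  (measurePreserving_add_right volume s).quasiMeasurePreserving.ae_eq_comp h

namespace IsSoliton

variable {v : ℝ} {f g : ℝ → ℂ}

lemma congr_ae (hg : IsSoliton v g) (h : f =ᵐ[volume] g) : IsSoliton v f := by
  obtain ⟨κ, c, hc, hκ, hgs⟩ := hg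
  exact ⟨κ, c, hc, hκ, h.trans hgs⟩

lemma const_mul (hf : IsSoliton v f) {z : ℂ} (hz : ‖z‖ = 1) : IsSoliton v fun x => z * f x := by
  obtain ⟨κ, c, hc, hκ, hfs⟩ := hf
  refine ⟨z * κ, c, hc, by rw [norm_mul, hz, one_mul, hκ], hfs.mono fun x hx => ?_⟩
  simp only [hx, soliton]
  ring

lemma comp_add (hf : IsSoliton v f) (s : ℝ) : IsSoliton v fun x => f (x + s) := by
  obtain ⟨κ, c, hc, hκ, hfs⟩ := hf
  have hs : ‖Complex.exp (I / 2 * v * s)‖ = 1 := by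
    rw [Complex.norm_exp]
    simp
  refine ⟨Complex.exp (I / 2 * v * s) * κ, s + c, by simpa using hc, ?_, ?_⟩
  · simpa [hs] using hκ
  · filter_upwards [ae_eq_comp_add hfs s] with x hx
    simp only [soliton] at hx ⊢
    rw [hx, Complex.ofReal_add, mul_add, Complex.exp_add, add_assoc]
    ring

lemma exists_ae_eq_groundState (hf : IsSoliton v f) :
    ∃ θ ∈ Ico (0 : ℝ) (2 * π), ∃ lam : ℝ, 0 < lam ∧ ∃ y : ℝ, f =ᵐ[volume] fun x : ℝ =>
      Complex.exp (I / 2 * v * x) * Complex.exp (I * θ) * (√lam : ℂ) *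
        groundState (lam * x + y) := by
  obtain ⟨κ, c, hc, hκ, hfs⟩ := hf
  obtain ⟨θ, hθ, lam, hlam, y, hs⟩ := exists_soliton_eq_groundState v hc hκ
  exact ⟨θ, hθ, lam, hlam, y, hfs.trans (ae_of_all _ hs)⟩

lemma mass_eq (hf : IsSoliton v f) : mass f = mass groundState := by
  obtain ⟨θ, -, lam, hlam, y, hfg⟩ := hf.exists_ae_eq_groundState
  have hscale : mass f = ∫ x : ℝ, lam * ‖groundState (lam * x + y)‖ ^ 2 := by
    refine integral_congr_ae (hfg.mono fun x hx => ?_)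
    have hphase : ‖Complex.exp (I / 2 * v * x) * Complex.exp (I * θ)‖ = 1 := by
      rw [← Complex.exp_add, Complex.norm_exp]
      simp
    simp only [hx]
    rw [norm_mul, norm_mul, hphase, one_mul, Complex.norm_real,
      Real.norm_of_nonneg (Real.sqrt_nonneg _), mul_pow, Real.sq_sqrt hlam.le]
  rw [hscale, integral_const_mul,
    Measure.integral_comp_mul_left (fun x => ‖groundState (x + y)‖ ^ 2) lam,
    integral_add_right_eq_self (fun x => ‖groundState x‖ ^ 2), abs_of_pos (inv_pos.2 hlam),
    smul_eq_mul, mul_inv_cancel_left₀ hlam.ne', mass]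

lemma memH1Plus_iff (hf : IsSoliton v f) (hf1 : MemH1 f) : MemH1Plus f ↔ 0 ≤ v := by
  obtain ⟨κ, c, hc, hκ, hfs⟩ := hf
  have hκ0 : κ ≠ 0 := by
    rintro rfl
    rw [norm_zero] at hκ
    linarith
  have h𝓕 := lpFourier_toLp_ae_eq_solitonSymbol hf1.memLp hc hfs
  rw [← ae_solitonSymbol_eq_zero_iff (c := c) hκ0]
  constructor
  · rintro ⟨-, hL, hneg⟩
    filter_upwards [hneg, h𝓕] with ξ h₁ h₂ hξ
    rw [← h₂, h₁ hξ]
  · refine fun h => ⟨hf1, hf1.memLp, ?_⟩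
    filter_upwards [h, h𝓕] with ξ h₁ h₂ hξ
    rw [h₂, h₁ hξ]

end IsSoliton

/-! ### Traveling waves -/

lemma hasDerivAt_integral_mul_comp_add {R φ : ℝ → ℂ} (hR : LocallyIntegrable R)
    (hφ : ContDiff ℝ 1 φ) (hs : HasCompactSupport φ) (v t : ℝ) :
    HasDerivAt (fun s : ℝ => ∫ x, R x * φ (x + v * s))
      (v * ∫ x, R x * deriv φ (x + v * t)) t := by
  have hconv := (hs.comp_homeomorph (Homeomorph.neg ℝ)).hasDerivAt_convolution_right
    (ContinuousLinearMap.mul ℝ ℂ) hR (hφ.comp contDiff_neg) (-(v * t))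
  have hshift : HasDerivAt (fun s : ℝ => -(v * s)) (-v) t := (hasDerivAt_const_mul v).neg
  refine ((hconv.scomp t hshift).congr_of_eventuallyEq
    (Eventually.of_forall fun s => ?_)).congr_deriv ?_
  · simp only [Function.comp_apply, convolution_def, ContinuousLinearMap.mul_apply',
      Homeomorph.coe_neg, neg_sub, sub_neg_eq_add]
  · have hd : ∀ x : ℝ, deriv (φ ∘ ⇑(Homeomorph.neg ℝ)) x = -deriv φ (-x) := deriv_comp_neg φ
    simp only [convolution_def, ContinuousLinearMap.mul_apply', hd, mul_neg, integral_neg,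
      neg_smul_neg, Complex.real_smul, neg_sub, sub_neg_eq_add]

namespace IsTravelingWave

variable {J : Set ℝ} {v ω : ℝ} {R : ℝ → ℂ} {u : ℝ → ℝ → ℂ} {t : ℝ}

lemma integral_mul_eq (h : IsTravelingWave J v ω R u) (ht : t ∈ J) (χ : ℝ → ℂ) :
    ∫ x, u t x * χ x = Complex.exp (I * ω * t) * ∫ x, R x * χ (x + v * t) := by
  rw [← integral_const_mul, ← integral_sub_right_eq_self
    (fun x => Complex.exp (I * ω * t) * (R x * χ (x + v * t))) (v * t)]
  refine integral_congr_ae ((h.form t ht).mono fun x hx => ?_)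
  simp only [hx, sub_add_cancel, mul_assoc]

lemma stationary_equation (h : IsTravelingWave J v ω R u) (ht : t ∈ J)
    (hJ : UniqueDiffWithinAt ℝ J t) {φ : ℝ → ℂ} (hφ : ContDiff ℝ (⊤ : ℕ∞) φ)
    (hs : HasCompactSupport φ) :
    I * ω * (∫ x, u t x * φ x) + v * ∫ x, u t x * deriv φ x =
      I * (∫ x, u t x * iteratedDeriv 2 φ x) +
        I * ∫ x, DAddAbsD (fun z => ((‖u t z‖ ^ 2 : ℝ) : ℂ)) x * u t x * φ x := by
  have hexp : HasDerivAt (fun s : ℝ => Complex.exp (I * ω * s))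
      (Complex.exp (I * ω * t) * (I * ω)) t := by
    simpa using! ((hasDerivAt_id (t : ℂ)).const_mul (I * ω)).cexp.comp_ofReal
  have hform : HasDerivWithinAt (fun s => ∫ x, u s x * φ x) _ J t :=
    (hexp.mul (hasDerivAt_integral_mul_comp_add (h.profile_memH1.memLp.locallyIntegrable one_le_two)
      (hφ.of_le (by exact_mod_cast le_top)) hs v t)).hasDerivWithinAt.congr
      (fun s hs => h.integral_mul_eq hs φ) (h.integral_mul_eq ht φ)
  rw [← hJ.eq_deriv _ hform (h.solution.equation t ht φ hφ hs), h.integral_mul_eq ht φ,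
    h.integral_mul_eq ht (deriv φ)]
  ring

lemma isWeakDeriv (h : IsTravelingWave J v ω R u) (ht : t ∈ J) (hJ : UniqueDiffWithinAt ℝ J t)
    {g : ℝ → ℂ} (hg : MemLp g 2) (hug : IsWeakDeriv (u t) g) :
    IsWeakDeriv g fun x =>
      ω * u t x + I * v * g x - DAddAbsD (fun z => ((‖u t z‖ ^ 2 : ℝ) : ℂ)) x * u t x := by
  intro φ hφ hs
  have hφ' := (contDiff_infty_iff_deriv.1 hφ).2
  have hu := (h.solution.memH1 t ht).memLp
  have heq := h.stationary_equation ht hJ hφ hs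
  rw [iteratedDeriv_succ, iteratedDeriv_one, hug _ hφ' hs.deriv, hug φ hφ hs] at heq
  set N : ℝ → ℂ := ⇑(DAddAbsD fun z => ((‖u t z‖ ^ 2 : ℝ) : ℂ))
  have iu := integrable_mul_of_hasCompactSupport
    ((hu.const_mul (ω : ℂ)).locallyIntegrable one_le_two) hφ.continuous hs
  have ig := integrable_mul_of_hasCompactSupport
    ((hg.const_mul (I * v)).locallyIntegrable one_le_two) hφ.continuous hs
  have iN : Integrable fun x => N x * u t x * φ x := integrable_mul_of_hasCompactSupport
    ((Lp.memLp _).integrable_mul hu).locallyIntegrable hφ.continuous hs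
  simp only [sub_mul, add_mul]
  rw [integral_sub (by exact iu.add ig) iN, integral_add iu ig]
  simp only [mul_assoc, integral_const_mul] at heq ⊢
  linear_combination (-I) * heq + (ω * (∫ x, u t x * φ x) + (∫ x, g x * deriv φ x) -
    ∫ x, N x * (u t x * φ x)) * Complex.I_sq

lemma exists_isPrimitive (h : IsTravelingWave J v ω R u) (ht : t ∈ J)
    (hJ : UniqueDiffWithinAt ℝ J t) :
    ∃ U U', u t =ᵐ[volume] U ∧ MemLp U 2 ∧ MemLp U' 2 ∧ IsPrimitive U U' ∧ IsPrimitive U' fun x =>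
      ω * U x + I * v * U' x - DAddAbsD (fun z => ((‖U z‖ ^ 2 : ℝ) : ℂ)) x * U x := by
  have hu := (h.solution.memH1 t ht).memLp
  obtain ⟨g, hg, hug⟩ := (h.solution.memH1 t ht).exists_isWeakDeriv
  obtain ⟨U, hU, huU⟩ := hug.exists_isPrimitive (hu.locallyIntegrable one_le_two)
    (hg.locallyIntegrable one_le_two)
  obtain ⟨U', hU', hgU'⟩ := (h.isWeakDeriv ht hJ hg hug).exists_isPrimitive
    (hg.locallyIntegrable one_le_two)
    ((((hu.const_mul (ω : ℂ)).add (hg.const_mul (I * v))).locallyIntegrable one_le_two).sub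
      ((Lp.memLp _).integrable_mul hu).locallyIntegrable)
  refine ⟨U, U', huU, (memLp_congr_ae huU).1 hu, (memLp_congr_ae hgU').1 hg, hU.congr_ae hgU',
    hU'.congr_ae ?_⟩
  have hN : DAddAbsD (fun z => ((‖u t z‖ ^ 2 : ℝ) : ℂ)) = DAddAbsD fun z => ((‖U z‖ ^ 2 : ℝ) : ℂ) :=
    dAddAbsD_congr_ae (huU.mono fun x hx => by simp only [hx])
  filter_upwards [huU, hgU'] with x hx hx'
  simp only [hN, Pi.sub_apply, Pi.add_apply, Pi.mul_apply, hx, hx']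

/-- The Galilean gauge `exp (-i v x / 2)` removes the first-order term from the equation. -/
lemma exists_isProfile (h : IsTravelingWave J v ω R u) (ht : t ∈ J)
    (hJ : UniqueDiffWithinAt ℝ J t) :
    ∃ Q q, (u t =ᵐ[volume] fun x => Complex.exp (I / 2 * v * x) * Q x) ∧
      IsProfile (ω - v ^ 2 / 4 : ℝ) Q q := by
  obtain ⟨U, U', huU, hU2, hU'2, hU, hU'⟩ := h.exists_isPrimitive ht hJ
  set c : ℂ := -(I / 2 * v)
  have hnorm : ∀ x : ℝ, ‖Complex.exp (c * x)‖ = 1 := fun x => by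
    simp [c, Complex.norm_exp]
  have hgauge : ∀ {f : ℝ → ℂ}, MemLp f 2 → MemLp (fun x : ℝ => Complex.exp (c * x) * f x) 2 :=
    fun hf => MemLp.of_le hf ((by fun_prop : Continuous fun x : ℝ => Complex.exp (c * x))
      |>.aestronglyMeasurable.mul hf.1) (ae_of_all _ fun x => by rw [norm_mul, hnorm, one_mul])
  have hq := ((hU.clm_comp (ContinuousLinearMap.mul ℝ ℂ c)).add hU').exp_mul c
  refine ⟨_, _, huU.mono fun x hx => ?_, IsProfile.of_isPrimitive (hU.exp_mul c)
    (hq.congr_ae (ae_of_all _ fun x => ?_)) (hgauge hU2)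
    (hgauge ((hU2.const_mul c).add hU'2))⟩
  · beta_reduce
    rw [hx, ← mul_assoc, ← Complex.exp_add, ← add_mul, add_neg_cancel, zero_mul, Complex.exp_zero,
      one_mul]
  · simp only [norm_mul, hnorm, one_mul, ContinuousLinearMap.mul_apply', c]
    push_cast
    linear_combination (v ^ 2 / 4 * Complex.exp (-(I / 2 * v) * x) * U x) * Complex.I_sq

lemma profile_ae_eq (h : IsTravelingWave J v ω R u) (ht : t ∈ J) :
    R =ᵐ[volume] fun x => Complex.exp (-(I * ω * t)) * u t (x + v * t) := by
  filter_upwards [ae_eq_comp_add (h.form t ht) (v * t)] with x hx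
  simp only [add_sub_cancel_right] at hx
  rw [hx, ← mul_assoc, ← Complex.exp_add, neg_add_cancel, Complex.exp_zero, one_mul]

lemma frequency_eq_and_isSoliton (h : IsTravelingWave J v ω R u) (ht : t ∈ J)
    (hJ : UniqueDiffWithinAt ℝ J t) : ω = v ^ 2 / 4 ∧ IsSoliton v R := by
  obtain ⟨Q, q, huQ, hQ⟩ := h.exists_isProfile ht hJ
  obtain ⟨x₀, hx₀⟩ : ∃ x₀, Q x₀ ≠ 0 := by
    by_contra! hQ0
    refine h.profile_ne_zero ?_
    filter_upwards [h.profile_ae_eq ht, ae_eq_comp_add huQ (v * t)] with x hx hx'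
    rw [hx, hx', hQ0, mul_zero, mul_zero, Pi.zero_apply]
  obtain ⟨κ, c, hc, hκ, hQκ⟩ := hQ.exists_eq_div hx₀
  have hu : IsSoliton v (u t) := ⟨κ, c, hc, hκ, by simpa only [hQκ] using! huQ⟩
  refine ⟨sub_eq_zero.1 (hQ.eigenvalue_eq_zero hx₀), IsSoliton.congr_ae
    ((hu.comp_add (v * t)).const_mul (z := Complex.exp (-(I * ω * t))) ?_) (h.profile_ae_eq ht)⟩
  simp [Complex.norm_exp]

lemma isSoliton_apply (h : IsTravelingWave J v ω R u) (hR : IsSoliton v R) (ht : t ∈ J) :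
    IsSoliton v (u t) := by
  refine ((hR.comp_add (-(v * t))).const_mul (z := Complex.exp (I * ω * t)) ?_).congr_ae
    (h.form t ht)
  simp [Complex.norm_exp]

lemma exists_ae_eq_groundState (h : IsTravelingWave J v ω R u) (hω : ω = v ^ 2 / 4)
    (hR : IsSoliton v R) : ∃ θ ∈ Ico (0 : ℝ) (2 * π), ∃ y : ℝ, ∃ lam : ℝ, 0 < lam ∧
      ∀ t ∈ J, u t =ᵐ[volume] fun x : ℝ =>
        Complex.exp (I * θ + I * (v / 2 : ℝ) * x - I * (v / 2 : ℝ) ^ 2 * t) * (√lam : ℂ) *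
          groundState (lam * (x - 2 * (v / 2 : ℝ) * t) + y) := by
  obtain ⟨θ, hθ, lam, hlam, y, hRg⟩ := hR.exists_ae_eq_groundState
  refine ⟨θ, hθ, y, lam, hlam, fun t ht => ?_⟩
  filter_upwards [h.form t ht, ae_eq_comp_add hRg (-(v * t))] with x hu hx
  rw [← sub_eq_add_neg] at hx
  rw [hu, hx, hω, mul_div_cancel₀ v two_ne_zero]
  simp only [← mul_assoc, ← Complex.exp_add]
  congr 3
  push_cast
  ring

end IsTravelingWave

end CMDNLS

theorem theorem1p2_general (J : Set ℝ) (hJ : ∃ t ∈ J, AccPt t (Filter.principal J)) :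
    (∀ (v ω : ℝ) (R : ℝ → ℂ) (u : ℝ → ℝ → ℂ), CMDNLS.IsTravelingWave J v ω R u →
      ω = v ^ 2 / 4 ∧
      (∃ θ ∈ Ico (0 : ℝ) (2 * Real.pi), ∃ lam : ℝ, 0 < lam ∧ ∃ y : ℝ,
        R =ᵐ[volume] fun x : ℝ =>
          Complex.exp (Complex.I / 2 * v * x) * Complex.exp (Complex.I * θ) *
            (Real.sqrt lam : ℂ) * CMDNLS.groundState (lam * x + y)) ∧
      (CMDNLS.MemH1Plus R ↔ 0 ≤ v) ∧
      (∀ t ∈ J, CMDNLS.mass (u t) = CMDNLS.mass CMDNLS.groundState)) ∧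
    (∀ u : ℝ → ℝ → ℂ,
      (∃ (v ω : ℝ) (R : ℝ → ℂ), CMDNLS.IsTravelingWave J v ω R u) →
      (∀ t ∈ J, CMDNLS.MemH1Plus (u t)) →
      (∃ θ ∈ Ico (0 : ℝ) (2 * Real.pi), ∃ y : ℝ, ∃ lam : ℝ, 0 < lam ∧ ∃ η : ℝ, 0 ≤ η ∧
        ∀ t ∈ J, u t =ᵐ[volume] fun x : ℝ =>
          Complex.exp (Complex.I * θ + Complex.I * η * x - Complex.I * η ^ 2 * t) *
            (Real.sqrt lam : ℂ) * CMDNLS.groundState (lam * (x - 2 * η * t) + y)) ∧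
      (∀ t ∈ J, CMDNLS.mass (u t) = CMDNLS.mass CMDNLS.groundState)) ∧
    CMDNLS.mass CMDNLS.groundState = 2 * Real.pi := by
  obtain ⟨t₀, ht₀, hacc⟩ := hJ
  have hsoliton : ∀ {v ω : ℝ} {R : ℝ → ℂ} {u : ℝ → ℝ → ℂ}, CMDNLS.IsTravelingWave J v ω R u →
      ω = v ^ 2 / 4 ∧ CMDNLS.IsSoliton v R := fun h =>
    h.frequency_eq_and_isSoliton ht₀ (uniqueDiffWithinAt_iff_accPt.2 hacc)
  refine ⟨fun v ω R u h => ?_, fun u ⟨v, ω, R, h⟩ hplus => ?_, CMDNLS.mass_groundState⟩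
  · obtain ⟨hω, hR⟩ := hsoliton h
    exact ⟨hω, hR.exists_ae_eq_groundState, hR.memH1Plus_iff h.profile_memH1,
      fun t ht => (h.isSoliton_apply hR ht).mass_eq⟩
  · obtain ⟨hω, hR⟩ := hsoliton h
    have hv : 0 ≤ v := ((h.isSoliton_apply hR ht₀).memH1Plus_iff
      (h.solution.memH1 t₀ ht₀)).1 (hplus t₀ ht₀)
    obtain ⟨θ, hθ, y, lam, hlam, hu⟩ := h.exists_ae_eq_groundState hω hR
    exact ⟨⟨θ, hθ, y, lam, hlam, v / 2, div_nonneg hv zero_le_two, hu⟩,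
      fun t ht => (h.isSoliton_apply hR ht).mass_eq⟩

theorem theorem1p2 (J : Set ℝ) (hJ : J.OrdConnected) (hJ' : J.Nontrivial) :
    -- every traveling solitary wave with a nonzero `H¹` profile
    (∀ (v ω : ℝ) (R : ℝ → ℂ) (u : ℝ → ℝ → ℂ), CMDNLS.IsTravelingWave J v ω R u →
      ω = v ^ 2 / 4 ∧
      (∃ θ ∈ Ico (0 : ℝ) (2 * Real.pi), ∃ lam : ℝ, 0 < lam ∧ ∃ y : ℝ,
        R =ᵐ[volume] fun x : ℝ =>
          Complex.exp (Complex.I / 2 * v * x) * Complex.exp (Complex.I * θ) *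
            (Real.sqrt lam : ℂ) * CMDNLS.groundState (lam * x + y)) ∧
      (CMDNLS.MemH1Plus R ↔ 0 ≤ v) ∧
      (∀ t ∈ J, CMDNLS.mass (u t) = CMDNLS.mass CMDNLS.groundState)) ∧
    -- every traveling solitary wave in `H¹₊`
    (∀ u : ℝ → ℝ → ℂ,
      (∃ (v ω : ℝ) (R : ℝ → ℂ), CMDNLS.IsTravelingWave J v ω R u) →
      (∀ t ∈ J, CMDNLS.MemH1Plus (u t)) →
      (∃ θ ∈ Ico (0 : ℝ) (2 * Real.pi), ∃ y : ℝ, ∃ lam : ℝ, 0 < lam ∧ ∃ η : ℝ, 0 ≤ η ∧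
        ∀ t ∈ J, u t =ᵐ[volume] fun x : ℝ =>
          Complex.exp (Complex.I * θ + Complex.I * η * x - Complex.I * η ^ 2 * t) *
            (Real.sqrt lam : ℂ) * CMDNLS.groundState (lam * (x - 2 * η * t) + y)) ∧
      (∀ t ∈ J, CMDNLS.mass (u t) = CMDNLS.mass CMDNLS.groundState)) ∧
    -- the critical mass
    CMDNLS.mass CMDNLS.groundState = 2 * Real.pi := by
  obtain ⟨t, ht⟩ := hJ'.nonempty
  exact theorem1p2_general J ⟨t, ht, hJ.isPreconnected.preperfect_of_nontrivial hJ' t ht⟩
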